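/- **Theorem (Invariant Manifold Theorem).** For $k=(k_1,k_2)\in\mathbb Z^2\setminus\{0\}$ write $|k|^2=k_1^2+k_2^2$, and put $$A(p,q)=\tfrac12\left(|q|^{-2}-|p|^{-2}\right)(p_1q_2-p_2q_1).$$ Let $\hat k=(-3,-2)$, $p=(1,1)$, $A_n=A(p,\hat k+np)$ and $A_{m,n}=A(\hat k+mp,\hat k+np)$ for $m,n\in\mathbb Z$. The *line model* (the Galerkin truncation of the 2D Euler equation, for real Fourier coefficients, on the modes $\hat k+np$ $(n\in\mathbb Z)$ and $p$) is the system $$\dot\omega_n=A_{n-1}\omega_p\omega_{n-1}-A_{n+1}\omega_p\omega_{n+1}\quad(n\in\mathbb Z),\qquad \dot\omega_p=-\sum_{n\in\mathbb Z}A_{n-1,n}\,\omega_{n-1}\omega_n$$ for real $\omega=(\omega_p,(\omega_n)_{n\in\mathbb Z})$. Let $s\ge1$ be real and let $H^s$ be the space of all such $\omega$ with $\sum_n|\hat k+np|^{2s}\omega_n^2<\infty$, with the corresponding topology. For real $\Gamma\neq0$ let $\omega^*_\Gamma$ be the fixed point $\omega_p=\Gamma$, $\omega_n=0$ for all $n$,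 and let $\ell=\{\omega^*_\Gamma:\Gamma\ne0\}$ be the line of fixed points. For a set $S\subset\mathbb C$, say that $W\subset H^s$ is an invariant manifold of $\ell$ of codimension $d$ associated with $S$ if 1. $\ell\subset W$, and $W$ is a smooth ($C^\infty$) embedded submanifold of $H^s$ of codimension $d$; 2. $W$ is locally invariant: there is an open set $U\supset W$ such that every solution of the line model on a time interval that stays in $U$ and meets $W$ stays in $W$ on the whole interval; 3. at each $\omega^*_\Gamma\in\ell$ the tangent space of $W$ is the spectral subspace, for the part of the spectrum in $S$, of the linearization of the line model at $\omega^*_\Gamma$. (The spectral subspace of a bounded operator $L$ for $S$ is a closed $L$-invariant subspace $E$ with a closed $L$-invariant complement $F$ such that the complex spectrum of $L|_E$ lies in $S$ and that of $L|_F$ in $\mathbb C\setminus S$.) It is a center-unstable, center-stable or center manifold if $S$ is $\{\operatorname{Re}z\ge0\}$, $\{\operatorname{Re}z\le0\}$ or $\{\operatorname{Re}z=0\}$, respectively. Then in $H^s$ the line of fixed points $\ell$ has a center-unstable manifold of codimension $2$, a center-stable manifold of codimension $2$, and a center manifold of codimension $4$. -/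

import Mathlib

open scoped TensorProduct

noncomputable section

/-! ### Modes and coefficients of the line model -/

/-- `|k|²` for a wave vector `k ∈ ℤ²`. -/
def waveNormSq (k : ℤ × ℤ) : ℝ := (k.1 : ℝ) ^ 2 + (k.2 : ℝ) ^ 2

/-- The interaction coefficient
`A(p, q) = (1/2) (|q|⁻² - |p|⁻²) (p₁ q₂ - p₂ q₁)` of the vorticity equation. -/
def eulerA (p q : ℤ × ℤ) : ℝ :=
  (1 / 2) * ((waveNormSq q)⁻¹ - (waveNormSq p)⁻¹) * ((p.1 : ℝ) * q.2 - (p.2 : ℝ) * q.1)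

/-- The mode `p = (1, 1)`. -/
def modeP : ℤ × ℤ := (1, 1)

/-- The modes `k̂ + n p` on the line, with `k̂ = (-3, -2)` and `p = (1, 1)`. -/
def lineMode (n : ℤ) : ℤ × ℤ := (-3, -2) + n • modeP

/-- `A_n = A(p, k̂ + n p)`. -/
def lineA (n : ℤ) : ℝ := eulerA modeP (lineMode n)

/-- `A_{m,n} = A(k̂ + m p, k̂ + n p)`. -/
def lineA₂ (m n : ℤ) : ℝ := eulerA (lineMode m) (lineMode n)

/-- `|k̂ + n p|²` as a function of `n`. -/
theorem waveNormSq_lineMode (n : ℤ) :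
    waveNormSq (lineMode n) = ((n : ℝ) - 3) ^ 2 + ((n : ℝ) - 2) ^ 2 := by
  simp only [waveNormSq, lineMode, modeP, Prod.fst_add, Prod.snd_add, Prod.smul_mk, smul_eq_mul]
  push_cast
  ring

/-- No mode on the line is the zero mode. -/
theorem one_le_waveNormSq_lineMode (n : ℤ) : 1 ≤ waveNormSq (lineMode n) := by
  rw [waveNormSq_lineMode]
  have h : (1 : ℤ) ≤ (n - 3) ^ 2 + (n - 2) ^ 2 := by
    rcases le_or_gt n 2 with h | h
    · nlinarith
    · nlinarith [Int.add_one_le_iff.mpr h]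
  exact_mod_cast h

/-! ### The Sobolev space of sequences on the line of modes -/

/-- The weight `|k̂ + n p|^s`. -/
def sobolevWeight (s : ℝ) (n : ℤ) : ℝ := (waveNormSq (lineMode n)) ^ (s / 2)

theorem sobolevWeight_pos (s : ℝ) (n : ℤ) : 0 < sobolevWeight s n :=
  Real.rpow_pos_of_pos (lt_of_lt_of_le one_pos (one_le_waveNormSq_lineMode n)) _

/-- The real sequences `(ω_n)` with `∑ |k̂ + n p|^(2s) ω_n² < ∞`, as a vector space. -/
def lineSobolevSubmodule (s : ℝ) : Submodule ℝ (ℤ → ℝ) where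
  carrier := {a | Memℓp (fun n => sobolevWeight s n * a n) 2}
  add_mem' {a b} ha hb := by
    have h := Memℓp.add ha hb
    refine (congrArg (fun f : ℤ → ℝ => Memℓp f 2) ?_).mp h
    funext n
    simp [mul_add]
  zero_mem' := by
    have h : Memℓp (0 : ℤ → ℝ) 2 := zero_memℓp
    refine (congrArg (fun f : ℤ → ℝ => Memℓp f 2) ?_).mp h
    funext n
    simp
  smul_mem' c a ha := by
    have h := Memℓp.const_smul ha c
    refine (congrArg (fun f : ℤ → ℝ => Memℓp f 2) ?_).mp h
    funext n
    simp only [Pi.smul_apply, smul_eq_mul]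
    ring

/-- The Sobolev space `H^s` of real sequences `(ω_n)` on the line of modes, with the norm
`(∑ |k̂ + n p|^(2s) ω_n²)^(1/2)` (a type synonym, so that the topology is the one of this norm and
not the one of coordinatewise convergence). -/
def LineSobolev (s : ℝ) : Type := lineSobolevSubmodule s

namespace LineSobolev

instance (s : ℝ) : AddCommGroup (LineSobolev s) :=
  inferInstanceAs (AddCommGroup (lineSobolevSubmodule s))

instance (s : ℝ) : Module ℝ (LineSobolev s) :=
  inferInstanceAs (Module ℝ (lineSobolevSubmodule s))

/-- The coefficients `ω_n`. -/
def coeff {s : ℝ} (a : LineSobolev s) : ℤ → ℝ := a.1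

/-- The sequence `(|k̂ + n p|^s ω_n)` as an element of `ℓ²`. -/
def toEll2 (s : ℝ) : LineSobolev s →ₗ[ℝ] lp (fun _ : ℤ => ℝ) 2 where
  toFun a := ⟨fun n => sobolevWeight s n * a.1 n, a.2⟩
  map_add' a b := by
    ext n
    exact mul_add _ _ _
  map_smul' c a := by
    ext n
    exact mul_left_comm _ _ _

theorem toEll2_injective (s : ℝ) : Function.Injective (toEll2 s) := by
  intro a b h
  apply Subtype.ext
  funext n
  have h' : sobolevWeight s n * a.1 n = sobolevWeight s n * b.1 n :=
    congrFun (congrArg Subtype.val h) n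
  exact mul_left_cancel₀ (sobolevWeight_pos s n).ne' h'

instance (s : ℝ) : NormedAddCommGroup (LineSobolev s) :=
  NormedAddCommGroup.induced _ _ (toEll2 s) (toEll2_injective s)

instance (s : ℝ) : NormedSpace ℝ (LineSobolev s) :=
  NormedSpace.induced ℝ (LineSobolev s) _ (toEll2 s)

end LineSobolev

/-- The phase space of the line model: `ω = (ω_p, (ω_n)_{n ∈ ℤ})` with `(ω_n) ∈ H^s`. -/
abbrev LinePhase (s : ℝ) : Type := ℝ × LineSobolev s

/-! ### The vector field of the line model -/

theorem abs_lineA_le (n : ℤ) : |lineA n| ≤ 1 := by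
  have h := one_le_waveNormSq_lineMode n
  have h0 : 0 ≤ (waveNormSq (lineMode n))⁻¹ := by positivity
  have h1 : (waveNormSq (lineMode n))⁻¹ ≤ 1 := inv_le_one_of_one_le₀ h
  have h2 : lineA n = (1 / 2) * ((waveNormSq (lineMode n))⁻¹ - 2⁻¹) := by
    simp only [lineA, eulerA]
    have h3 : waveNormSq modeP = 2 := by norm_num [waveNormSq, modeP]
    rw [h3]
    simp only [lineMode, modeP, Prod.fst_add, Prod.snd_add, Prod.smul_mk, smul_eq_mul]
    push_cast
    ring
  rw [h2, abs_le]
  constructor <;> linarith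

/-- The weights of two neighbouring modes are comparable. -/
theorem sobolevWeight_le (s : ℝ) {m n : ℤ} (h : m = n + 1 ∨ n = m + 1) :
    sobolevWeight s n ≤ 6 ^ (|s| / 2) * sobolevWeight s m := by
  have key : ∀ i j : ℤ, (i = j + 1 ∨ j = i + 1) →
      waveNormSq (lineMode j) ≤ 6 * waveNormSq (lineMode i) := by
    intro i j hij
    have h1 := one_le_waveNormSq_lineMode i
    rw [waveNormSq_lineMode] at h1 ⊢
    rw [waveNormSq_lineMode]
    rcases hij with rfl | rfl
    · push_cast at h1 ⊢
      nlinarith [sq_nonneg (2 * (j : ℝ) - 3)]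
    · push_cast at h1 ⊢
      nlinarith [sq_nonneg (2 * (i : ℝ) - 5)]
  have hm : 0 < waveNormSq (lineMode m) :=
    lt_of_lt_of_le one_pos (one_le_waveNormSq_lineMode m)
  have hn : 0 < waveNormSq (lineMode n) :=
    lt_of_lt_of_le one_pos (one_le_waveNormSq_lineMode n)
  unfold sobolevWeight
  rcases le_total 0 s with hs | hs
  · rw [abs_of_nonneg hs, ← Real.mul_rpow (by norm_num) hm.le]
    exact Real.rpow_le_rpow hn.le (key m n h) (by linarith)
  · rw [abs_of_nonpos hs]
    have h1 : waveNormSq (lineMode m) ^ (-s / 2) ≤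
        6 ^ (-s / 2) * waveNormSq (lineMode n) ^ (-s / 2) := by
      rw [← Real.mul_rpow (by norm_num) hn.le]
      exact Real.rpow_le_rpow hm.le (key n m h.symm) (by linarith)
    have e : s / 2 = -(-s / 2) := by ring
    rw [e, Real.rpow_neg hn.le, Real.rpow_neg hm.le]
    have hm' := Real.rpow_pos_of_pos hm (-s / 2)
    have hn' := Real.rpow_pos_of_pos hn (-s / 2)
    rw [← div_eq_mul_inv, inv_eq_one_div, div_le_div_iff₀ hn' hm']
    linarith

/-- `n ↦ A_{n+j} a_{n+j}` is in `H^s` if `a` is, for `j = 1` and `j = -1`. -/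
theorem shift_mem_lineSobolev {s : ℝ} {a : ℤ → ℝ} (ha : a ∈ lineSobolevSubmodule s)
    {j : ℤ} (hj : j = 1 ∨ j = -1) :
    (fun n => lineA (n + j) * a (n + j)) ∈ lineSobolevSubmodule s := by
  have ha' : Memℓp (fun n => sobolevWeight s n * a n) 2 := ha
  have hinj : Function.Injective (fun n : ℤ => n + j) := add_left_injective j
  change Memℓp (fun n => sobolevWeight s n * (lineA (n + j) * a (n + j))) 2
  rw [memℓp_gen_iff (by norm_num)] at ha' ⊢
  have hsh := (ha'.comp_injective hinj).mul_left ((6 ^ (|s| / 2) : ℝ) ^ (2 : ENNReal).toReal)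
  refine Summable.of_nonneg_of_le (fun n => by positivity) (fun n => ?_) hsh
  simp only [Function.comp]
  have h6 : (0 : ℝ) ≤ 6 ^ (|s| / 2) := by positivity
  rw [← Real.mul_rpow h6 (norm_nonneg _)]
  refine Real.rpow_le_rpow (norm_nonneg _) ?_ (by norm_num)
  have hw := sobolevWeight_le s (m := n + j) (n := n) (by omega)
  have hA := abs_lineA_le (n + j)
  simp only [norm_mul, Real.norm_eq_abs, abs_of_pos (sobolevWeight_pos s _)]
  have h0 := sobolevWeight_pos s n
  calc sobolevWeight s n * (|lineA (n + j)| * |a (n + j)|)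
      ≤ sobolevWeight s n * (1 * |a (n + j)|) := by gcongr
    _ ≤ (6 ^ (|s| / 2) * sobolevWeight s (n + j)) * (1 * |a (n + j)|) := by gcongr
    _ = 6 ^ (|s| / 2) * (sobolevWeight s (n + j) * |a (n + j)|) := by ring

theorem lineField_mem {s : ℝ} (c : ℝ) {a : ℤ → ℝ} (ha : a ∈ lineSobolevSubmodule s) :
    (fun n => lineA (n - 1) * c * a (n - 1) - lineA (n + 1) * c * a (n + 1)) ∈
      lineSobolevSubmodule s := by
  have h1 := shift_mem_lineSobolev ha (j := -1) (Or.inr rfl)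
  have h2 := shift_mem_lineSobolev ha (j := 1) (Or.inl rfl)
  have h3 := Submodule.smul_mem _ c (Submodule.sub_mem _ h1 h2)
  refine (congrArg (· ∈ lineSobolevSubmodule s) ?_).mp h3
  funext n
  simp only [Pi.smul_apply, Pi.sub_apply, smul_eq_mul, ← sub_eq_add_neg]
  ring

/-- The right-hand side of the line model
`ω_p' = - ∑_n A_{n-1,n} ω_{n-1} ω_n`, `ω_n' = A_{n-1} ω_p ω_{n-1} - A_{n+1} ω_p ω_{n+1}`. -/
def lineField (s : ℝ) (ω : LinePhase s) : LinePhase s :=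
  (-∑' n : ℤ, lineA₂ (n - 1) n * ω.2.coeff (n - 1) * ω.2.coeff n,
    ⟨fun n => lineA (n - 1) * ω.1 * ω.2.coeff (n - 1) - lineA (n + 1) * ω.1 * ω.2.coeff (n + 1),
      lineField_mem ω.1 ω.2.2⟩)

/-- The fixed point `ω*` with parameter `Γ`: `ω_p = Γ` and `ω_n = 0` for all `n`. -/
def lineFixedPoint (s Γ : ℝ) : LinePhase s := (Γ, 0)

/-- The line of fixed points `ω*`, parametrized by `Γ ≠ 0`. -/
def fixedLine (s : ℝ) : Set (LinePhase s) := {ω | ∃ Γ : ℝ, Γ ≠ 0 ∧ ω = lineFixedPoint s Γ}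

/-! ### Spectral subspaces, submanifolds and invariant manifolds -/

section InvariantManifolds

variable {X : Type*} [NormedAddCommGroup X] [NormedSpace ℝ X]

/-- The complex spectrum of a bounded operator `A` on a real space: its spectrum in the
complexification `ℂ ⊗ B(X)` of the algebra of bounded operators on `X`, that is, the spectrum of the
complex-linear extension of `A` to the complexification of `X`. -/
def complexSpectrum (A : X →L[ℝ] X) : Set ℂ :=
  spectrum ℂ ((1 : ℂ) ⊗ₜ[ℝ] A : ℂ ⊗[ℝ] (X →L[ℝ] X))

/-- `E` is the spectral subspace of `A` for the part of the spectrum in `S`: there is a decomposition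
of the space into closed `A`-invariant subspaces `E` and `F` such that the spectrum of `A` on `E` is
in `S` and the spectrum of `A` on `F` is in the complement of `S`. -/
def IsSpectralSubspace (A : X →L[ℝ] X) (S : Set ℂ) (E : Submodule ℝ X) : Prop :=
  ∃ (F : Submodule ℝ X) (hE : ∀ v ∈ E, A v ∈ E) (hF : ∀ v ∈ F, A v ∈ F),
    IsClosed (E : Set X) ∧ IsClosed (F : Set X) ∧ IsCompl E F ∧
    complexSpectrum (A.restrict hE) ⊆ S ∧ complexSpectrum (A.restrict hF) ⊆ Sᶜ

/-- On the open neighbourhood `U` of `x`, the set `W` is the zero set of the smooth submersion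
`G : U → ℝ^d`. -/
structure IsLocalDefiningMap (W : Set X) (x : X) {d : ℕ} (U : Set X) (G : X → Fin d → ℝ) :
    Prop where
  isOpen : IsOpen U
  mem : x ∈ U
  smooth : ContDiffOn ℝ (⊤ : ℕ∞) G U
  mem_iff : ∀ y ∈ U, (y ∈ W ↔ G y = 0)
  submersion : ∀ y ∈ U, Function.Surjective (fderiv ℝ G y)

/-- `W` is a smooth (embedded) submanifold of codimension `d`. -/
def IsSmoothSubmanifold (W : Set X) (d : ℕ) : Prop :=
  ∀ x ∈ W, ∃ (U : Set X) (G : X → Fin d → ℝ), IsLocalDefiningMap W x U G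

/-- `T` is the tangent space at `x` of the smooth submanifold `W` of codimension `d`: the kernel of
the derivative at `x` of a local defining map. -/
def HasTangentSpaceAt (W : Set X) (d : ℕ) (x : X) (T : Submodule ℝ X) : Prop :=
  ∃ (U : Set X) (G : X → Fin d → ℝ), IsLocalDefiningMap W x U G ∧
    T = LinearMap.ker (fderiv ℝ G x : X →ₗ[ℝ] (Fin d → ℝ))

/-- `W` is locally invariant (forward and backward in time) for `x' = f x`, relative to the open set
`U`: a solution on a time interval which meets `W` stays in `W` as long as it stays in `U`. -/
def IsInvariantRelative (f : X → X) (W U : Set X) : Prop :=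
  ∀ (I : Set ℝ) (γ : ℝ → X), I.OrdConnected → IsIntegralCurveOn γ (fun _ => f) I →
    (∀ t ∈ I, γ t ∈ U) → (∃ t ∈ I, γ t ∈ W) → ∀ t ∈ I, γ t ∈ W

/-- `W` is a smooth invariant manifold of codimension `d` of the set `P` of fixed points of
`x' = f x`, associated with the part `S` of the complex plane: `W` contains `P`, is a smooth
submanifold of codimension `d`, is locally invariant in a neighbourhood of `P`, and at every point of
`P` it is tangent to the spectral subspace, for the part of the spectrum in `S`, of the linearization
of `f`. For `S = {Re ≥ 0}`, `{Re ≤ 0}` and `{Re = 0}` these are the center-unstable, center-stable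
and center manifolds. -/
structure IsInvariantManifoldOf (f : X → X) (P : Set X) (S : Set ℂ) (d : ℕ) (W : Set X) :
    Prop where
  fixed : ∀ x ∈ P, f x = 0
  subset : P ⊆ W
  submanifold : IsSmoothSubmanifold W d
  invariant : ∃ U : Set X, IsOpen U ∧ W ⊆ U ∧ IsInvariantRelative f W U
  tangent : ∀ x ∈ P, ∃ A : X →L[ℝ] X, HasFDerivAt f A x ∧
    ∃ T : Submodule ℝ X, IsSpectralSubspace A S T ∧ HasTangentSpaceAt W d x T

/-- A center-unstable manifold of codimension `d`. -/
def IsCenterUnstableManifold (f : X → X) (P : Set X) (d : ℕ) (W : Set X) : Prop :=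
  IsInvariantManifoldOf f P {z | 0 ≤ z.re} d W

/-- A center-stable manifold of codimension `d`. -/
def IsCenterStableManifold (f : X → X) (P : Set X) (d : ℕ) (W : Set X) : Prop :=
  IsInvariantManifoldOf f P {z | z.re ≤ 0} d W

/-- A center manifold of codimension `d`. -/
def IsCenterManifold (f : X → X) (P : Set X) (d : ℕ) (W : Set X) : Prop :=
  IsInvariantManifoldOf f P {z | z.re = 0} d W

end InvariantManifolds

end

/-!
The vector field is `(c, a) ↦ (q a, c L a)` with `c = ω_p`, `a = (ω_n)`, a quadratic form `q` and
the bounded operator `(L a)_n = A_{n-1} a_{n-1} - A_{n+1} a_{n+1}`. Up to a change of time the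
equation for `a` is linear, so if a bounded projection `P` commutes with `L`, then `P a` solves
`(P a)' = c L (P a)`, and `P a = 0` persists as long as the solution exists. Hence the invariant
manifolds are flat: the union of `{c > 0, P a = 0}` and `{c < 0, P' a = 0}`, where `P` and `P'` are
the spectral projections of `L` and `-L` for the part of the spectrum outside `S`
(`isInvariantManifoldOf_signedKernel`). What has to be shown is that the spectrum of `L` off the
imaginary axis consists of four simple eigenvalues `±λ`, `±λ̄`, two in each half-plane.

*At most four.* The operator `L` is skew for the form `B a b = ∑ A_n a_n b_n`, and `A_n < 0` except
for `n = 2, 3`. It commutes with `(K a)_n = (-1)^n a_{5-n}`, which satisfies `K² = -1` and preserves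
`B`. With `K` as the imaginary unit, the form has a single positive direction
(`isPontryaginSkew_line`). Eigenvectors off the imaginary axis are neutral, and two of them with
eigenvalues `λ` and `-λ̄` span a hyperbolic plane on whose orthogonal complement the form is
negative definite, so that no further eigenvector of this kind exists
(`IsDualPair.eq_zero_of_shiftOp`).

*Fredholm alternative.* The coefficients tend to `-1/4` and ratios of neighbouring Sobolev weights
to `1`. So `L` on `H^s`, seen on `ℓ²`, is a compact perturbation of a skew-adjoint operator with
constant coefficients, and by Lax-Milgram `L - (x + y K)` is a compact perturbation of an invertible
operator for `x ≠ 0` (`isUnitAddCompact_shiftOp_line`). Injectivity then gives invertibility. The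
complex spectrum of a real operator is reached through the real operator `(A - z)(A - z̄)`
(`notMem_complexSpectrum`).

*Existence.* Eigenvectors compatible with `K` correspond to one complex sequence on `n ≥ 3` with a
boundary condition at `n = 3`. The ratios of consecutive values of a decaying solution form the
continued fraction `r k = 1 / (b_k μ + r (k + 1))`, `b_k = -1 / A_{k+4}`, and the boundary condition
is `4 μ = r 0 + i`. Its right-hand side, divided by `4`, is a contraction of a small disc in the
right half-plane (`exists_fraction_fixedPoint`). The fixed point gives an eigenvector that decays
exponentially, hence lies in every `H^s`, and the reflection `a_n ↦ a_{5-n}` gives the second one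
(`exists_isDualPair_line`).
-/

/-! ### Spectra of operators on real Banach spaces -/

section SpectralTheory

variable {X : Type*} [NormedAddCommGroup X] [NormedSpace ℝ X]

/-- The real quadratic polynomial `(A - z)(A - z̄) = A² - 2 Re z A + |z|²` in the operator `A`. -/
def quadShift (A : X →L[ℝ] X) (z : ℂ) : X →L[ℝ] X :=
  A * A - (2 * z.re) • A + Complex.normSq z • 1

theorem quadShift_apply (A : X →L[ℝ] X) (z : ℂ) (v : X) :
    quadShift A z v = A (A v) - (2 * z.re) • A v + Complex.normSq z • v := rfl

theorem sub_mul_sub_expand {R : Type*} [Ring R] (a b c d : R) :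
    (a - b) * (c - d) = a * c - a * d - b * c + b * d := by
  noncomm_ring

/-- In the complexified algebra, `(A - z)(A - z̄)` is the real operator `quadShift A z`, so `z` is
in the resolvent set as soon as this real operator is invertible. -/
theorem notMem_complexSpectrum [CompleteSpace X] {A : X →L[ℝ] X} {z : ℂ}
    (h : Function.Bijective (quadShift A z)) : z ∉ complexSpectrum A := by
  have hu : IsUnit (quadShift A z) := ContinuousLinearMap.isUnit_iff_bijective.mpr h
  have hu' : IsUnit ((1 : ℂ) ⊗ₜ[ℝ] quadShift A z : ℂ ⊗[ℝ] (X →L[ℝ] X)) :=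
    hu.map (Algebra.TensorProduct.includeRight : (X →L[ℝ] X) →ₐ[ℝ] ℂ ⊗[ℝ] (X →L[ℝ] X))
  rw [complexSpectrum, spectrum.notMem_iff, Algebra.TensorProduct.algebraMap_apply,
    Algebra.algebraMap_self_apply]
  have key : ∀ w w' : ℂ, w + w' = ((2 * z.re : ℝ) : ℂ) → w * w' = (Complex.normSq z : ℂ) →
      (w ⊗ₜ[ℝ] (1 : X →L[ℝ] X) - (1 : ℂ) ⊗ₜ[ℝ] A) * (w' ⊗ₜ[ℝ] (1 : X →L[ℝ] X) - (1 : ℂ) ⊗ₜ[ℝ] A)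
        = (1 : ℂ) ⊗ₜ[ℝ] quadShift A z := by
    intro w w' h1 h2
    have e1 : (2 * z.re) • ((1 : ℂ) ⊗ₜ[ℝ] A) = w ⊗ₜ[ℝ] A + w' ⊗ₜ[ℝ] A := by
      rw [← TensorProduct.add_tmul, h1, TensorProduct.smul_tmul', Complex.real_smul, mul_one]
    have e2 : Complex.normSq z • ((1 : ℂ) ⊗ₜ[ℝ] (1 : X →L[ℝ] X)) = (w * w') ⊗ₜ[ℝ] 1 := by
      rw [h2, TensorProduct.smul_tmul', Complex.real_smul, mul_one]
    rw [quadShift, TensorProduct.tmul_add, TensorProduct.tmul_sub, TensorProduct.tmul_smul,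
      TensorProduct.tmul_smul, e1, e2]
    refine (sub_mul_sub_expand _ _ _ _).trans ?_
    simp only [Algebra.TensorProduct.tmul_mul_tmul, one_mul, mul_one]
    abel
  have hsum : z + (starRingEnd ℂ) z = ((2 * z.re : ℝ) : ℂ) := by
    rw [Complex.add_conj]
  have hprod : z * (starRingEnd ℂ) z = (Complex.normSq z : ℂ) := Complex.mul_conj z
  have hc : Commute (z ⊗ₜ[ℝ] (1 : X →L[ℝ] X) - (1 : ℂ) ⊗ₜ[ℝ] A)
      ((starRingEnd ℂ) z ⊗ₜ[ℝ] (1 : X →L[ℝ] X) - (1 : ℂ) ⊗ₜ[ℝ] A) := by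
    rw [Commute, SemiconjBy, key _ _ hsum hprod, key _ _ (by rw [add_comm, hsum])
      (by rw [mul_comm, hprod])]
  exact (hc.isUnit_mul_iff.mp (by rw [key _ _ hsum hprod]; exact hu')).1

/-- `T` is a compact perturbation of an invertible operator, that is, Fredholm of index zero. -/
def IsUnitAddCompact (T : X →L[ℝ] X) : Prop :=
  ∃ J : X →L[ℝ] X, IsUnit J ∧ IsCompactOperator (T - J : X →L[ℝ] X)

theorem IsUnitAddCompact.add_compact {T C : X →L[ℝ] X} (hT : IsUnitAddCompact T)
    (hC : IsCompactOperator C) : IsUnitAddCompact (T + C) := by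
  obtain ⟨J, hJ, hTJ⟩ := hT
  refine ⟨J, hJ, ?_⟩
  have := hTJ.add hC
  rw [← FunLike.coe_add, show T - J + C = T + C - J by abel] at this
  exact this

theorem IsUnitAddCompact.mul {T T' : X →L[ℝ] X} (hT : IsUnitAddCompact T)
    (hT' : IsUnitAddCompact T') : IsUnitAddCompact (T * T') := by
  obtain ⟨J, hJ, hTJ⟩ := hT
  obtain ⟨J', hJ', hTJ'⟩ := hT'
  refine ⟨J * J', hJ.mul hJ', ?_⟩
  have h := (hTJ.comp_clm T').add (hTJ'.clm_comp J)
  rw [show T * T' - J * J' = (T - J) * T' + J * (T' - J') by noncomm_ring]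
  exact h

theorem IsUnitAddCompact.smul {T : X →L[ℝ] X} (hT : IsUnitAddCompact T) {c : ℝ} (hc : c ≠ 0) :
    IsUnitAddCompact (c • T) := by
  obtain ⟨J, hJ, hTJ⟩ := hT
  refine ⟨c • J, ?_, ?_⟩
  · have := hJ.smul (Units.mk0 c hc)
    exact this
  · rw [← smul_sub]
    exact hTJ.smul c

/-- The Fredholm alternative: an injective compact perturbation of an invertible operator is
invertible. -/
theorem IsUnitAddCompact.isUnit [CompleteSpace X] {T : X →L[ℝ] X} (hT : IsUnitAddCompact T)
    (hinj : ∀ v, T v = 0 → v = 0) : IsUnit T := by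
  obtain ⟨J, ⟨u, rfl⟩, hC⟩ := hT
  set C : X →L[ℝ] X := T - u with hCdef
  set S : X →L[ℝ] X := -((u⁻¹ : (X →L[ℝ] X)ˣ) * C) with hS
  have hScomp : IsCompactOperator S := (hC.clm_comp ((u⁻¹ : (X →L[ℝ] X)ˣ) : X →L[ℝ] X)).neg
  have hT : T = u * (1 - S) := by
    rw [hS, sub_neg_eq_add, mul_add, mul_one, ← mul_assoc, Units.mul_inv, one_mul, hCdef]
    abel
  rcases hScomp.hasEigenvalue_or_mem_resolventSet (one_ne_zero : (1 : ℝ) ≠ 0) with h | h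
  · exfalso
    obtain ⟨v, hv⟩ := h.exists_hasEigenvector
    refine hv.2 (hinj v ?_)
    have h1 : S v = v := by simpa using hv.apply_eq_smul
    rw [hT]
    simp [h1]
  · rw [hT]
    refine u.isUnit.mul ?_
    have := spectrum.mem_resolventSet_iff.mp h
    simpa using this

/-- An operator commuting with a finite-rank projection `P` and Fredholm of index zero is onto on
`ker P` as soon as it is injective there. -/
theorem IsUnitAddCompact.surjOn_ker [CompleteSpace X] {T P : X →L[ℝ] X} (hT : IsUnitAddCompact T)
    (hP : IsCompactOperator P) (hPP : ∀ a, P (P a) = P a) (hTP : ∀ a, T (P a) = P (T a))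
    (hinj : ∀ a, P a = 0 → T a = 0 → a = 0) {b : X} (hb : P b = 0) :
    ∃ a, P a = 0 ∧ T a = b := by
  -- `T` on `ker P`, extended by the identity of the range of `P`, is still index zero
  have hC : ∀ C : X →L[ℝ] X, IsCompactOperator (C * P : X →L[ℝ] X) := fun C => hP.clm_comp C
  have h' : IsUnitAddCompact (T + (1 - T) * P) := hT.add_compact (hC (1 - T))
  have happ : ∀ a, (T + (1 - T) * P) a = T a + (P a - T (P a)) := fun a => rfl
  have hPapp : ∀ a, P ((T + (1 - T) * P) a) = P a := by
    intro a
    rw [happ, map_add, map_sub, hPP, hTP, hPP]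
    abel
  have hu := h'.isUnit (fun a ha => by
    have h1 : P a = 0 := by rw [← hPapp, ha, map_zero]
    refine hinj a h1 ?_
    rw [happ, h1, map_zero, sub_zero, add_zero] at ha
    exact ha)
  obtain ⟨a, ha⟩ := (ContinuousLinearMap.isUnit_iff_bijective.mp hu).2 b
  have h1 : P a = 0 := by rw [← hPapp, ha, hb]
  refine ⟨a, h1, ?_⟩
  rw [happ, h1, map_zero, sub_zero, add_zero] at ha
  exact ha

end SpectralTheory

/-! ### Manifolds for fields that are linear up to a change of time -/

section LinearUpToTime

variable {H : Type*} [NormedAddCommGroup H] [NormedSpace ℝ H]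

/-- The spectral subspace of `(c, a) ↦ (0, B a)` for a set `S ∋ 0`, when `P` is the spectral
projection of `B` for the complement of `S`. -/
theorem isSpectralSubspace_prod [CompleteSpace H] {B P : H →L[ℝ] H} {S : Set ℂ}
    (hfin : FiniteDimensional ℝ (LinearMap.range (P : H →ₗ[ℝ] H)))
    (hPP : ∀ a, P (P a) = P a) (hBP : ∀ a, B (P a) = P (B a)) (h0 : (0 : ℂ) ∈ S)
    (hcomp : ∀ z ∉ S, IsUnitAddCompact (quadShift B z))
    (hker : ∀ z ∉ S, ∀ a, P a = 0 → quadShift B z a = 0 → a = 0)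
    (hrange : ∀ z ∈ S, ∀ a, P a = a → quadShift B z a = 0 → a = 0) :
    IsSpectralSubspace ((0 : ℝ →L[ℝ] ℝ).prodMap B) S
      (LinearMap.ker ((P ∘L ContinuousLinearMap.snd ℝ ℝ H : ℝ × H →L[ℝ] H) :
        ℝ × H →ₗ[ℝ] H)) := by
  set E : Submodule ℝ (ℝ × H) := LinearMap.ker ((P ∘L ContinuousLinearMap.snd ℝ ℝ H :
    ℝ × H →L[ℝ] H) : ℝ × H →ₗ[ℝ] H) with hE
  set F : Submodule ℝ (ℝ × H) := (LinearMap.range (P : H →ₗ[ℝ] H)).map (LinearMap.inr ℝ ℝ H)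
    with hF
  have memE : ∀ w : ℝ × H, w ∈ E ↔ P w.2 = 0 := fun w => Iff.rfl
  have memF : ∀ w : ℝ × H, w ∈ F ↔ w.1 = 0 ∧ P w.2 = w.2 := by
    rintro ⟨c, a⟩
    constructor
    · rintro ⟨_, ⟨b, rfl⟩, h⟩
      simp only [LinearMap.inr_apply, Prod.mk.injEq, ContinuousLinearMap.coe_coe] at h
      obtain ⟨rfl, rfl⟩ := h
      exact ⟨rfl, hPP b⟩
    · rintro ⟨h1, h2⟩
      exact ⟨a, ⟨a, h2⟩, by simp only at h1; rw [h1]; rfl⟩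
  have hPcomp : IsCompactOperator P := by
    have := isCompactOperator_of_locallyCompactSpace_rng
      ((LinearMap.range (P : H →ₗ[ℝ] H)).subtypeL)
    exact this.comp_clm (P.codRestrict _ (fun a => LinearMap.mem_range_self (P : H →ₗ[ℝ] H) a))
  have hqP : ∀ z a, quadShift B z (P a) = P (quadShift B z a) := by
    intro z a
    simp only [quadShift_apply, map_add, map_sub, map_smul, hBP]
  have hAE : ∀ v ∈ E, (0 : ℝ →L[ℝ] ℝ).prodMap B v ∈ E := by
    intro v hv
    rw [memE] at hv ⊢
    change P (B v.2) = 0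
    rw [← hBP, hv, map_zero]
  have hAF : ∀ v ∈ F, (0 : ℝ →L[ℝ] ℝ).prodMap B v ∈ F := by
    intro v hv
    rw [memF] at hv ⊢
    refine ⟨rfl, ?_⟩
    change P (B v.2) = B v.2
    rw [← hBP, hv.2]
  have hfinF : FiniteDimensional ℝ F := by rw [hF]; infer_instance
  have hEc : IsClosed (E : Set (ℝ × H)) := ContinuousLinearMap.isClosed_ker _
  have hFc : IsClosed (F : Set (ℝ × H)) := F.closed_of_finiteDimensional
  have hEcomp : CompleteSpace E := hEc.completeSpace_coe
  have hFcomp : CompleteSpace F := hFc.completeSpace_coe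
  have hqE : ∀ (z : ℂ) (v : E), ((quadShift (((0 : ℝ →L[ℝ] ℝ).prodMap B).restrict hAE) z v : E) :
      ℝ × H) = (Complex.normSq z * v.1.1, quadShift B z v.1.2) := by
    intro z v
    ext
    · change (0 : ℝ) - (2 * z.re) * 0 + _ = _
      simp
    · rfl
  have hqF : ∀ (z : ℂ) (v : F), ((quadShift (((0 : ℝ →L[ℝ] ℝ).prodMap B).restrict hAF) z v : F) :
      ℝ × H) = (Complex.normSq z * v.1.1, quadShift B z v.1.2) := by
    intro z v
    ext
    · change (0 : ℝ) - (2 * z.re) * 0 + _ = _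
      simp
    · rfl
  refine ⟨F, hAE, hAF, hEc, hFc, ?_, ?_, ?_⟩
  · constructor
    · rw [Submodule.disjoint_def]
      intro w h1 h2
      rw [memE] at h1
      rw [memF] at h2
      exact Prod.ext h2.1 (by rw [← h2.2, h1]; rfl)
    · rw [codisjoint_iff, eq_top_iff]
      rintro ⟨c, a⟩ -
      refine Submodule.mem_sup.mpr ⟨(c, a - P a), ?_, (0, P a), ?_, ?_⟩
      · rw [memE]
        simp [hPP]
      · rw [memF]
        exact ⟨rfl, hPP a⟩
      · simp
  · intro z hz
    by_contra hzS
    refine notMem_complexSpectrum ?_ hz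
    have hz0 : Complex.normSq z ≠ 0 := by
      rw [Ne, Complex.normSq_eq_zero]
      rintro rfl
      exact hzS h0
    constructor
    · rw [injective_iff_map_eq_zero]
      intro v hv
      have h1 := hqE z v
      rw [hv] at h1
      have h2 := congrArg Prod.fst h1
      have h3 := congrArg Prod.snd h1
      simp only [ZeroMemClass.coe_zero, Prod.fst_zero, Prod.snd_zero] at h2 h3
      apply Subtype.ext
      refine Prod.ext ?_ (hker z hzS _ v.2 h3.symm)
      simpa [hz0] using h2.symm
    · rintro ⟨⟨c, b⟩, hb⟩
      obtain ⟨a, ha, hab⟩ := (hcomp z hzS).surjOn_ker hPcomp hPP (hqP z) (hker z hzS) hb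
      refine ⟨⟨((Complex.normSq z)⁻¹ * c, a), ha⟩, Subtype.ext ?_⟩
      rw [hqE]
      simp [hz0, hab]
  · intro z hz hzS
    refine notMem_complexSpectrum ?_ hz
    have hinj : Function.Injective
        (quadShift (((0 : ℝ →L[ℝ] ℝ).prodMap B).restrict hAF) z) := by
      rw [injective_iff_map_eq_zero]
      intro v hv
      have h1 := hqF z v
      rw [hv] at h1
      have h3 := congrArg Prod.snd h1
      simp only [ZeroMemClass.coe_zero, Prod.snd_zero] at h3
      have h4 := (memF v.1).mp v.2
      exact Subtype.ext (Prod.ext h4.1 (hrange z hzS _ h4.2 h3.symm))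
    exact ⟨hinj, LinearMap.injective_iff_surjective.mp hinj⟩

/-- A solution of `a' = c(t) L a` that vanishes at one time vanishes identically. -/
theorem eq_zero_of_linear_ode {u : ℝ → H} {c : ℝ → ℝ} {L : H →L[ℝ] H} {I : Set ℝ}
    (hI : I.OrdConnected) (hc : ContinuousOn c I)
    (hu : ∀ t ∈ I, HasDerivWithinAt u (c t • L (u t)) I t) {t₀ : ℝ} (ht₀ : t₀ ∈ I)
    (h0 : u t₀ = 0) : ∀ t ∈ I, u t = 0 := by
  -- the forward statement on a compact interval, from which both time directions follow
  have key : ∀ (w : ℝ → H) (k : ℝ → ℝ) (T : ℝ), 0 ≤ T → ContinuousOn k (Set.Icc 0 T) →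
      (∀ t ∈ Set.Icc 0 T, HasDerivWithinAt w (k t • L (w t)) (Set.Icc 0 T) t) →
      w 0 = 0 → w T = 0 := by
    intro w k T hT hk hw hw0
    obtain ⟨M, hM⟩ := isCompact_Icc.exists_bound_of_continuousOn hk
    have hM0 : 0 ≤ M := (norm_nonneg _).trans (hM 0 ⟨le_rfl, hT⟩)
    have hb := norm_le_gronwallBound_of_norm_deriv_right_le (f := w)
      (f' := fun t => k t • L (w t)) (δ := 0) (K := M * ‖L‖) (ε := 0) (a := 0) (b := T)
      (fun t ht => (hw t ht).continuousWithinAt)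
      (fun t ht => (hw t ⟨ht.1, ht.2.le⟩).mono_of_mem_nhdsWithin
        (Filter.mem_of_superset (Icc_mem_nhdsGE ht.2) (Set.Icc_subset_Icc_left ht.1)))
      (by rw [hw0, norm_zero])
      (fun t ht => by
        rw [norm_smul, add_zero, mul_assoc]
        exact mul_le_mul (hM t ⟨ht.1, ht.2.le⟩) (L.le_opNorm _) (norm_nonneg _) hM0)
    have h1 := hb T ⟨hT, le_rfl⟩
    rw [gronwallBound_ε0_δ0] at h1
    exact norm_le_zero_iff.mp h1
  intro t ht
  rcases le_total t₀ t with h | h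
  · have hsub : ∀ τ ∈ Set.Icc 0 (t - t₀), t₀ + τ ∈ I := fun τ hτ =>
      hI.out ht₀ ht ⟨by linarith [hτ.1], by linarith [hτ.2]⟩
    have := key (fun τ => u (t₀ + τ)) (fun τ => c (t₀ + τ)) (t - t₀) (by linarith)
      (hc.comp (by fun_prop) hsub)
      (fun τ hτ => by
        have h1 := (hu _ (hsub τ hτ)).scomp τ
          (((hasDerivAt_id τ).const_add t₀).hasDerivWithinAt (s := Set.Icc 0 (t - t₀))) hsub
        rw [one_smul] at h1
        exact h1)
      (by simpa using h0)
    simpa using this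
  · have hsub : ∀ τ ∈ Set.Icc 0 (t₀ - t), t₀ - τ ∈ I := fun τ hτ =>
      hI.out ht ht₀ ⟨by linarith [hτ.2], by linarith [hτ.1]⟩
    have := key (fun τ => u (t₀ - τ)) (fun τ => -c (t₀ - τ)) (t₀ - t) (by linarith)
      ((hc.comp (by fun_prop) hsub).neg)
      (fun τ hτ => by
        have h1 := (hu _ (hsub τ hτ)).scomp τ
          (((hasDerivAt_id τ).const_sub t₀).hasDerivWithinAt (s := Set.Icc 0 (t₀ - t))) hsub
        rw [neg_one_smul, ← neg_smul] at h1
        exact h1)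
      (by simpa using h0)
    simpa using this

/-- The operator `a ↦ ∑ i, φ i a • e i`, the projection onto the span of `e` along the common kernel
of the `φ i` when the two families are biorthogonal. -/
def biorthProj {d : ℕ} (φ : Fin d → H →L[ℝ] ℝ) (e : Fin d → H) : H →L[ℝ] H :=
  ∑ i, (φ i).smulRight (e i)

theorem biorthProj_apply {d : ℕ} (φ : Fin d → H →L[ℝ] ℝ) (e : Fin d → H) (a : H) :
    biorthProj φ e a = ∑ i, φ i a • e i := by
  simp [biorthProj]

/-- `φ` and `e` are biorthogonal. -/
def IsBiorth {d : ℕ} (φ : Fin d → H →L[ℝ] ℝ) (e : Fin d → H) : Prop :=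
  ∀ i j, φ i (e j) = if i = j then 1 else 0

namespace IsBiorth

variable {d : ℕ} {φ : Fin d → H →L[ℝ] ℝ} {e : Fin d → H}

theorem apply_sum (h : IsBiorth φ e) (c : Fin d → ℝ) (i : Fin d) :
    φ i (∑ j, c j • e j) = c i := by
  simp [map_sum, h i]

theorem apply_biorthProj (h : IsBiorth φ e) (a : H) (i : Fin d) :
    φ i (biorthProj φ e a) = φ i a := by
  rw [biorthProj_apply, h.apply_sum]

theorem biorthProj_idem (h : IsBiorth φ e) (a : H) :
    biorthProj φ e (biorthProj φ e a) = biorthProj φ e a := by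
  rw [biorthProj_apply]
  simp only [h.apply_biorthProj]
  rw [biorthProj_apply]

theorem biorthProj_eq_zero_iff (h : IsBiorth φ e) (a : H) :
    biorthProj φ e a = 0 ↔ ∀ i, φ i a = 0 := by
  constructor
  · intro h0 i
    rw [← h.apply_biorthProj, h0, map_zero]
  · intro h0
    rw [biorthProj_apply]
    simp [h0]

end IsBiorth

theorem finiteDimensional_range_biorthProj {d : ℕ} (φ : Fin d → H →L[ℝ] ℝ) (e : Fin d → H) :
    FiniteDimensional ℝ (LinearMap.range (biorthProj φ e : H →ₗ[ℝ] H)) := by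
  have hle : LinearMap.range (biorthProj φ e : H →ₗ[ℝ] H) ≤ Submodule.span ℝ (Set.range e) := by
    rintro _ ⟨a, rfl⟩
    rw [ContinuousLinearMap.coe_coe, biorthProj_apply]
    exact Submodule.sum_mem _ fun i _ =>
      Submodule.smul_mem _ _ (Submodule.subset_span ⟨i, rfl⟩)
  have := FiniteDimensional.span_of_finite ℝ (Set.finite_range e)
  exact Submodule.finiteDimensional_of_le hle

/-- The set of the `(c, a)` with `c > 0`, `P a = 0` or `c < 0`, `P' a = 0`. -/
def signedKernel (P P' : H →L[ℝ] H) : Set (ℝ × H) :=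
  {w | (0 < w.1 ∧ P w.2 = 0) ∨ (w.1 < 0 ∧ P' w.2 = 0)}

/-- A set that coincides on an open set with the common kernel of biorthogonal functionals is
defined there by these functionals. -/
theorem IsBiorth.isLocalDefiningMap {d : ℕ} {φ : Fin d → H →L[ℝ] ℝ} {e : Fin d → H}
    (h : IsBiorth φ e) {W U : Set (ℝ × H)} (hU : IsOpen U) {x : ℝ × H} (hx : x ∈ U)
    (hW : ∀ w ∈ U, (w ∈ W ↔ biorthProj φ e w.2 = 0)) :
    IsLocalDefiningMap W x U
      (ContinuousLinearMap.pi φ ∘L ContinuousLinearMap.snd ℝ ℝ H : ℝ × H →L[ℝ] (Fin d → ℝ)) where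
  isOpen := hU
  mem := hx
  smooth := (ContinuousLinearMap.contDiff _).contDiffOn
  mem_iff y hy := by
    rw [hW y hy, h.biorthProj_eq_zero_iff]
    exact ⟨fun h => funext h, fun h i => congrFun h i⟩
  submersion y hy := by
    rw [ContinuousLinearMap.fderiv]
    intro c
    exact ⟨(0, ∑ j, c j • e j), funext fun i => h.apply_sum c i⟩

/-- For a field `(c, a) ↦ (q a, c L a)`, which is linear in `a` up to a change of time, the kernels
of finite-rank projections commuting with `L` give invariant manifolds of the line `a = 0`, `c ≠ 0`.
The projections for `c > 0` and `c < 0` differ because `c L` reverses sign. -/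
theorem isInvariantManifoldOf_signedKernel [CompleteSpace H] {L : H →L[ℝ] H} {q : H → ℝ}
    {f : ℝ × H → ℝ × H} (hf : ∀ w, f w = (q w.2, w.1 • L w.2)) (hq0 : q 0 = 0)
    (hq : HasFDerivAt q (0 : H →L[ℝ] ℝ) 0) {S : Set ℂ} (h0 : (0 : ℂ) ∈ S) {d : ℕ}
    {φ φ' : Fin d → H →L[ℝ] ℝ} {e e' : Fin d → H} (h : IsBiorth φ e) (h' : IsBiorth φ' e')
    (hL : ∀ a, L (biorthProj φ e a) = biorthProj φ e (L a))
    (hL' : ∀ a, L (biorthProj φ' e' a) = biorthProj φ' e' (L a))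
    (hcomp : ∀ Γ : ℝ, Γ ≠ 0 → ∀ z ∉ S, IsUnitAddCompact (quadShift (Γ • L) z))
    (hker : ∀ Γ : ℝ, 0 < Γ → ∀ z ∉ S, ∀ a, biorthProj φ e a = 0 →
      quadShift (Γ • L) z a = 0 → a = 0)
    (hrange : ∀ Γ : ℝ, 0 < Γ → ∀ z ∈ S, ∀ a, biorthProj φ e a = a →
      quadShift (Γ • L) z a = 0 → a = 0)
    (hker' : ∀ Γ : ℝ, Γ < 0 → ∀ z ∉ S, ∀ a, biorthProj φ' e' a = 0 →
      quadShift (Γ • L) z a = 0 → a = 0)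
    (hrange' : ∀ Γ : ℝ, Γ < 0 → ∀ z ∈ S, ∀ a, biorthProj φ' e' a = a →
      quadShift (Γ • L) z a = 0 → a = 0) :
    IsInvariantManifoldOf f {w | ∃ Γ : ℝ, Γ ≠ 0 ∧ w = (Γ, 0)} S d
      (signedKernel (biorthProj φ e) (biorthProj φ' e')) := by
  set W := signedKernel (biorthProj φ e) (biorthProj φ' e') with hWdef
  have hpos : IsOpen {w : ℝ × H | 0 < w.1} := isOpen_lt continuous_const continuous_fst
  have hneg : IsOpen {w : ℝ × H | w.1 < 0} := isOpen_lt continuous_fst continuous_const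
  have hWpos : ∀ w ∈ {w : ℝ × H | 0 < w.1}, (w ∈ W ↔ biorthProj φ e w.2 = 0) := fun w hw =>
    ⟨fun hwW => hwW.elim (fun h => h.2) (fun h => absurd hw h.1.not_gt), fun h => Or.inl ⟨hw, h⟩⟩
  have hWneg : ∀ w ∈ {w : ℝ × H | w.1 < 0}, (w ∈ W ↔ biorthProj φ' e' w.2 = 0) := fun w hw =>
    ⟨fun hwW => hwW.elim (fun h => absurd hw h.1.not_gt) (fun h => h.2), fun h => Or.inr ⟨hw, h⟩⟩
  have hW0 : ∀ w ∈ W, w.1 ≠ 0 := fun w hw =>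
    hw.elim (fun h => h.1.ne') (fun h => h.1.ne)
  have hder : ∀ Γ : ℝ, HasFDerivAt f ((0 : ℝ →L[ℝ] ℝ).prodMap (Γ • L)) (Γ, 0) := by
    intro Γ
    have h1 : HasFDerivAt (fun w : ℝ × H => q w.2)
        ((0 : H →L[ℝ] ℝ) ∘L ContinuousLinearMap.snd ℝ ℝ H) (Γ, 0) :=
      HasFDerivAt.comp (Γ, (0 : H)) (f := Prod.snd) (g := q) hq hasFDerivAt_snd
    have h2 : HasFDerivAt (fun w : ℝ × H => w.1 • L w.2) _ (Γ, 0) :=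
      hasFDerivAt_fst.smul (L.hasFDerivAt.comp (Γ, (0 : H)) hasFDerivAt_snd)
    have h3 := h1.prodMk h2
    rw [show f = fun w => (q w.2, w.1 • L w.2) from funext hf]
    refine h3.congr_fderiv ?_
    ext <;> simp
  refine ⟨?_, ?_, ?_, ⟨{w | w.1 ≠ 0}, ?_, hW0, ?_⟩, ?_⟩
  · rintro _ ⟨Γ, -, rfl⟩
    rw [hf]
    simp [hq0]
  · rintro _ ⟨Γ, hΓ, rfl⟩
    rcases hΓ.lt_or_gt with hΓ | hΓ
    · exact Or.inr ⟨hΓ, map_zero _⟩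
    · exact Or.inl ⟨hΓ, map_zero _⟩
  · rintro x (hx | hx)
    · exact ⟨_, _, h.isLocalDefiningMap hpos hx.1 hWpos⟩
    · exact ⟨_, _, h'.isLocalDefiningMap hneg hx.1 hWneg⟩
  · exact isOpen_ne_fun continuous_fst continuous_const
  · intro I γ hI hγ hU ⟨t₀, ht₀, hW⟩ t ht
    have hcont : ContinuousOn (fun t => (γ t).1) I := fun t ht =>
      ((hγ t ht).continuousWithinAt).fst
    have hsnd : ∀ t ∈ I, HasDerivWithinAt (fun t => (γ t).2) ((γ t).1 • L (γ t).2) I t := by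
      intro t ht
      have h1 : HasDerivWithinAt γ (f (γ t)) I t := hγ t ht
      rw [hf] at h1
      exact (hasFDerivAt_snd (p := γ t)).comp_hasDerivWithinAt t h1
    have hproj : ∀ P : H →L[ℝ] H, (∀ a, L (P a) = P (L a)) → P (γ t₀).2 = 0 → P (γ t).2 = 0 := by
      intro P hP hP0
      refine eq_zero_of_linear_ode (u := fun t => P (γ t).2) (L := L) hI hcont ?_ ht₀ hP0 t ht
      intro τ hτ
      have h1 := P.hasFDerivAt.comp_hasDerivWithinAt τ (hsnd τ hτ)
      rw [map_smul, ← hP] at h1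
      exact h1
    -- the first component has no zero on the interval, hence a constant sign
    have hsign : 0 < (γ t₀).1 * (γ t).1 := by
      by_contra hle
      have hconn := hI.isPreconnected.image _ hcont
      have h0mem : (0 : ℝ) ∈ (fun t => (γ t).1) '' I := by
        rcases (hU t₀ ht₀).lt_or_gt with h1 | h1
        · exact hconn.ordConnected.out ⟨t₀, ht₀, rfl⟩ ⟨t, ht, rfl⟩
            ⟨h1.le, by simp only; nlinarith⟩
        · exact hconn.ordConnected.out ⟨t, ht, rfl⟩ ⟨t₀, ht₀, rfl⟩
            ⟨by simp only; nlinarith, h1.le⟩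
      obtain ⟨τ, hτ, hτ0⟩ := h0mem
      exact hU τ hτ hτ0
    rcases hW with hW | hW
    · exact Or.inl ⟨(pos_iff_pos_of_mul_pos hsign).mp hW.1, hproj _ hL hW.2⟩
    · exact Or.inr ⟨(neg_iff_neg_of_mul_pos hsign).mp hW.1, hproj _ hL' hW.2⟩
  · rintro _ ⟨Γ, hΓ, rfl⟩
    refine ⟨_, hder Γ, ?_⟩
    rcases hΓ.lt_or_gt with hΓ | hΓ
    · refine ⟨_, isSpectralSubspace_prod (P := biorthProj φ' e')
        (finiteDimensional_range_biorthProj φ' e') h'.biorthProj_idem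
        (fun a => by simp [hL']) h0 (hcomp Γ hΓ.ne) (hker' Γ hΓ) (hrange' Γ hΓ), ?_⟩
      refine ⟨_, _, h'.isLocalDefiningMap hneg hΓ hWneg, ?_⟩
      rw [ContinuousLinearMap.fderiv]
      ext w
      exact (h'.biorthProj_eq_zero_iff w.2).trans
        ⟨fun h => funext h, fun h i => congrFun h i⟩
    · refine ⟨_, isSpectralSubspace_prod (P := biorthProj φ e)
        (finiteDimensional_range_biorthProj φ e) h.biorthProj_idem
        (fun a => by simp [hL]) h0 (hcomp Γ hΓ.ne') (hker Γ hΓ) (hrange Γ hΓ), ?_⟩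
      refine ⟨_, _, h.isLocalDefiningMap hpos hΓ hWpos, ?_⟩
      rw [ContinuousLinearMap.fderiv]
      ext w
      exact (h.biorthProj_eq_zero_iff w.2).trans
        ⟨fun h => funext h, fun h i => congrFun h i⟩

end LinearUpToTime

/-! ### Skew operators for an indefinite form -/

section Krein

variable {H : Type*} [NormedAddCommGroup H] [NormedSpace ℝ H]

/-- `L` is skew for the symmetric form `B`, commutes with the complex structure `K`, which preserves
`B`, and `B` is negative definite on the common kernel of the real and imaginary parts `η`, `ξ` of a
complex functional. In complex terms, `H` is a Pontryagin space of positive index at most one. -/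
structure IsPontryaginSkew (L K : H →L[ℝ] H) (B : H →L[ℝ] H →L[ℝ] ℝ) (ξ η : H →L[ℝ] ℝ) :
    Prop where
  K_sq : ∀ a, K (K a) = -a
  comm : ∀ a, L (K a) = K (L a)
  symm : ∀ a b, B a b = B b a
  K_iso : ∀ a b, B (K a) (K b) = B a b
  skew : ∀ a b, B (L a) b = -B a (L b)
  xi_K : ∀ a, ξ (K a) = -η a
  eta_K : ∀ a, η (K a) = ξ a
  neg : ∀ a, ξ a = 0 → η a = 0 → 0 ≤ B a a → a = 0

/-- `L - (x + y K)`, where `K` plays the role of the imaginary unit. -/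
def shiftOp (L K : H →L[ℝ] H) (x y : ℝ) : H →L[ℝ] H := L - x • 1 - y • K

theorem shiftOp_apply (L K : H →L[ℝ] H) (x y : ℝ) (a : H) :
    shiftOp L K x y a = L a - x • a - y • K a := rfl

variable {L K : H →L[ℝ] H} {B : H →L[ℝ] H →L[ℝ] ℝ} {ξ η : H →L[ℝ] ℝ}

namespace IsPontryaginSkew

theorem K_left (h : IsPontryaginSkew L K B ξ η) (a b : H) : B (K a) b = -B a (K b) := by
  rw [← h.K_iso (K a) b, h.K_sq, map_neg, neg_apply]

theorem K_self (h : IsPontryaginSkew L K B ξ η) (a : H) : B a (K a) = 0 := by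
  have h1 := h.K_left a a
  rw [h.symm (K a) a] at h1
  linarith

/-- The factorization `(A - z)(A - z̄)` with `K` as imaginary unit, after scaling `A = Γ L`. -/
theorem quadShift_smul (h : IsPontryaginSkew L K B ξ η) {Γ : ℝ} (hΓ : Γ ≠ 0) (z : ℂ) :
    quadShift (Γ • L) z =
      (Γ ^ 2) • (shiftOp L K (z.re / Γ) (z.im / Γ) * shiftOp L K (z.re / Γ) (-(z.im / Γ))) := by
  ext a
  rw [quadShift_apply]
  change _ = (Γ ^ 2) • (shiftOp L K _ _ (shiftOp L K _ _ a))
  simp only [shiftOp_apply, map_sub, map_smul, h.comm, h.K_sq, smul_apply,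
    Complex.normSq_apply]
  match_scalars <;> field_simp <;> ring

/-- The form vanishes on eigenvectors off the imaginary axis. -/
theorem self_eq_zero (h : IsPontryaginSkew L K B ξ η) {x y : ℝ} (hx : x ≠ 0) {a : H}
    (ha : L a = x • a + y • K a) : B a a = 0 := by
  have h1 := h.skew a a
  rw [h.symm a (L a), ha] at h1
  simp only [map_add, map_smul, add_apply, smul_apply,
    h.K_left a a, h.K_self, smul_eq_mul] at h1
  have : x * B a a = 0 := by linarith
  exact (mul_eq_zero.mp this).resolve_left hx

/-- If `w` is an eigenvector for `-x₀ + y₀ K`, then the complex functional `B w` is an eigenvector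
of the adjoint for `x₀ + y₀ K`: it vanishes at `a` if it vanishes at `(L - (x + y K)) a`, `x ≠ x₀`.
-/
theorem pairing_eq_zero (h : IsPontryaginSkew L K B ξ η) {x₀ y₀ x y : ℝ} {w a : H}
    (hw : L w = (-x₀) • w + y₀ • K w) (hx : x ≠ x₀) (h1 : B w (shiftOp L K x y a) = 0)
    (h2 : B (K w) (shiftOp L K x y a) = 0) : B w a = 0 ∧ B (K w) a = 0 := by
  have e1 : B w (L a) = x₀ * B w a - y₀ * B (K w) a := by
    have := h.skew w a
    rw [hw] at this
    simp only [map_add, map_smul, add_apply, smul_apply,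
      smul_eq_mul] at this
    linarith
  have e2 : B (K w) (L a) = x₀ * B (K w) a + y₀ * B w a := by
    have := h.skew (K w) a
    rw [h.comm, hw] at this
    simp only [map_add, map_smul, add_apply, smul_apply,
      h.K_sq, map_neg, neg_apply, smul_eq_mul] at this
    linarith
  have e3 : B w (K a) = -B (K w) a := by rw [h.K_left, neg_neg]
  simp only [shiftOp_apply, map_sub, map_smul, smul_eq_mul, e1, e2, e3, h.K_iso] at h1 h2
  have hpos : 0 < (x - x₀) ^ 2 := by positivity [sub_ne_zero.mpr hx]
  have hsum : ((x - x₀) ^ 2 + (y - y₀) ^ 2) * (B w a ^ 2 + B (K w) a ^ 2) = 0 := by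
    have e : ((x - x₀) ^ 2 + (y - y₀) ^ 2) * (B w a ^ 2 + B (K w) a ^ 2) =
      (x₀ * B w a - y₀ * B (K w) a - x * B w a - y * -B (K w) a) ^ 2 +
      (x₀ * B (K w) a + y₀ * B w a - x * B (K w) a - y * B w a) ^ 2 := by ring
    rw [e, h1, h2]
    norm_num
  have hz := (mul_eq_zero.mp hsum).resolve_left (by positivity)
  constructor <;> nlinarith [sq_nonneg (B w a), sq_nonneg (B (K w) a)]

/-- Modulo the complex line of a nonzero nonnegative vector `e`, every vector lies in the common
kernel of `ξ` and `η`. -/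
theorem exists_sub_mem_ker (h : IsPontryaginSkew L K B ξ η) {e : H} (he0 : e ≠ 0)
    (he : 0 ≤ B e e) (a : H) :
    ∃ α β : ℝ, ξ (a - α • e - β • K e) = 0 ∧ η (a - α • e - β • K e) = 0 := by
  have hn : 0 < ξ e ^ 2 + η e ^ 2 := by
    by_contra hle
    have hξ : ξ e = 0 := by nlinarith [sq_nonneg (ξ e), sq_nonneg (η e)]
    have hη : η e = 0 := by nlinarith [sq_nonneg (ξ e), sq_nonneg (η e)]
    exact he0 (h.neg e hξ hη he)
  -- `α + i β` is the quotient of the complex values `ξ + i η` at `a` and at `e`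
  refine ⟨(ξ a * ξ e + η a * η e) / (ξ e ^ 2 + η e ^ 2),
    (η a * ξ e - ξ a * η e) / (ξ e ^ 2 + η e ^ 2), ?_, ?_⟩
  · simp only [map_sub, map_smul, h.xi_K, smul_eq_mul]
    field_simp
    ring
  · simp only [map_sub, map_smul, h.eta_K, smul_eq_mul]
    field_simp
    ring

/-- A nonnegative vector orthogonal to a complex line on which the form is positive vanishes:
otherwise the two would span a nonnegative subspace too large to avoid the kernel of `ξ`, `η`. -/
theorem eq_zero_of_orthogonal (h : IsPontryaginSkew L K B ξ η) {e a : H} (he : 0 < B e e)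
    (h1 : B e a = 0) (h2 : B (K e) a = 0) (ha : 0 ≤ B a a) : a = 0 := by
  have he0 : e ≠ 0 := by
    rintro rfl
    simp at he
  obtain ⟨α, β, hbξ, hbη⟩ := h.exists_sub_mem_ker he0 he.le a
  set b := a - α • e - β • K e with hb
  have hbb : B b b = B a a + (α ^ 2 + β ^ 2) * B e e := by
    have h3 : B a e = 0 := by rw [h.symm, h1]
    have h4 : B a (K e) = 0 := by rw [h.symm, h2]
    have h5 : B (K e) e = 0 := by rw [h.symm, h.K_self]
    simp only [hb, map_sub, map_smul, sub_apply,
      smul_apply, smul_eq_mul, h1, h2, h3, h4, h5, h.K_iso, h.K_self]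
    ring
  have hb0 := h.neg b hbξ hbη (by rw [hbb]; positivity)
  rw [hb0] at hbb
  simp only [map_zero] at hbb
  have hαβ : (α ^ 2 + β ^ 2) * B e e = 0 := by
    have : 0 ≤ (α ^ 2 + β ^ 2) * B e e := by positivity
    linarith
  have hαβ' := (mul_eq_zero.mp hαβ).resolve_right he.ne'
  have hα0 : α = 0 := by nlinarith [sq_nonneg α, sq_nonneg β]
  have hβ0 : β = 0 := by nlinarith [sq_nonneg α, sq_nonneg β]
  rw [hb, hα0, hβ0] at hb0
  simpa using hb0

/-- Eigenvectors for `x + y K` and `-x + y K` cannot be orthogonal, since they would span a neutral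
subspace of complex dimension two. -/
theorem exists_dual_eigenvector (h : IsPontryaginSkew L K B ξ η) {x y : ℝ} (hx : x ≠ 0) {v w : H}
    (hv0 : v ≠ 0) (hw0 : w ≠ 0) (hv : L v = x • v + y • K v) (hw : L w = (-x) • w + y • K w) :
    ∃ w', L w' = (-x) • w' + y • K w' ∧ B v w' = 1 ∧ B v (K w') = 0 := by
  have hvv := h.self_eq_zero hx hv
  have hww := h.self_eq_zero (neg_ne_zero.mpr hx) hw
  set p := B v w with hp
  set q := B v (K w) with hq
  have hpq : 0 < p ^ 2 + q ^ 2 := by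
    by_contra hle
    have hp0 : p = 0 := by nlinarith [sq_nonneg p, sq_nonneg q]
    have hq0 : q = 0 := by nlinarith [sq_nonneg p, sq_nonneg q]
    obtain ⟨α, β, hbξ, hbη⟩ := h.exists_sub_mem_ker hw0 hww.ge v
    set b := v - α • w - β • K w with hb
    have hbb : B b b = 0 := by
      have h1 : B w v = 0 := by rw [h.symm, ← hp, hp0]
      have h2 : B (K w) v = 0 := by rw [h.symm, ← hq, hq0]
      have h5 : B (K w) w = 0 := by rw [h.symm, h.K_self]
      simp only [hb, map_sub, map_smul, sub_apply,
        smul_apply, smul_eq_mul, h1, h2, ← hp, ← hq, hp0, hq0, hvv, hww, h5,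
        h.K_iso, h.K_self]
      ring
    have hb0 := h.neg b hbξ hbη hbb.ge
    have hvw : v = α • w + β • K w := by
      rw [hb, sub_sub, sub_eq_zero] at hb0
      exact hb0
    have h6 : L v = (-x) • v + y • K v := by
      rw [hvw]
      simp only [map_add, map_smul, h.comm, hw, h.K_sq]
      module
    have h7 : (2 * x) • v = 0 := by
      rw [show (2 * x) • v = (x • v + y • K v) - ((-x) • v + y • K v) by module, ← hv, ← h6,
        sub_self]
    exact (smul_ne_zero (mul_ne_zero two_ne_zero hx) hv0) h7
  refine ⟨(p / (p ^ 2 + q ^ 2)) • w + (q / (p ^ 2 + q ^ 2)) • K w, ?_, ?_, ?_⟩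
  · simp only [map_add, map_smul, h.comm, hw, h.K_sq]
    module
  · simp only [map_add, map_smul, smul_eq_mul, ← hp, ← hq]
    field_simp
  · simp only [map_add, map_smul, smul_eq_mul, ← hp, ← hq, h.K_sq, map_neg]
    field_simp
    ring

end IsPontryaginSkew

/-- `v` and `w` are eigenvectors for `x + y K` and `-x + y K`, dual with respect to the hermitian
form with real part `B`. -/
structure IsDualPair (L K : H →L[ℝ] H) (B : H →L[ℝ] H →L[ℝ] ℝ) (x y : ℝ) (v w : H) : Prop where
  left : L v = x • v + y • K v
  right : L w = (-x) • w + y • K w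
  pair : B v w = 1
  pair_K : B v (K w) = 0

/-- The functionals `B w`, `B (K w)`: the real and imaginary parts of the complex functional dual
to `w`. -/
noncomputable def pairFunctional (K : H →L[ℝ] H) (B : H →L[ℝ] H →L[ℝ] ℝ) (w : H) :
    Fin 2 → H →L[ℝ] ℝ :=
  ![B w, B (K w)]

/-- The real basis `v`, `K v` of the complex line of `v`. -/
def pairVector (K : H →L[ℝ] H) (v : H) : Fin 2 → H := ![v, K v]

/-- The functionals of both members of a dual pair. -/
noncomputable def quadFunctional (K : H →L[ℝ] H) (B : H →L[ℝ] H →L[ℝ] ℝ) (v w : H) :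
    Fin 4 → H →L[ℝ] ℝ :=
  ![B w, B (K w), B v, B (K v)]

/-- The real basis of the complex span of a dual pair. -/
def quadVector (K : H →L[ℝ] H) (v w : H) : Fin 4 → H := ![v, K v, w, K w]

theorem biorthProj_pair (B : H →L[ℝ] H →L[ℝ] ℝ) (v w a : H) :
    biorthProj (pairFunctional K B w) (pairVector K v) a = B w a • v + B (K w) a • K v := by
  simp [biorthProj_apply, Fin.sum_univ_two, pairFunctional, pairVector]

theorem biorthProj_quad (B : H →L[ℝ] H →L[ℝ] ℝ) (v w a : H) :
    biorthProj (quadFunctional K B v w) (quadVector K v w) a =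
      biorthProj (pairFunctional K B w) (pairVector K v) a +
        biorthProj (pairFunctional K B v) (pairVector K w) a := by
  rw [biorthProj_pair, biorthProj_pair]
  simp [biorthProj_apply, Fin.sum_univ_four, quadFunctional, quadVector]
  abel

namespace IsDualPair

variable {x y : ℝ} {v w : H}

theorem swap (hp : IsDualPair L K B x y v w) (h : IsPontryaginSkew L K B ξ η) :
    IsDualPair L K B (-x) y w v where
  left := hp.right
  right := by rw [neg_neg]; exact hp.left
  pair := by rw [h.symm, hp.pair]
  pair_K := by rw [h.symm, h.K_left, hp.pair_K, neg_zero]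

theorem isBiorth_pair (hp : IsDualPair L K B x y v w) (h : IsPontryaginSkew L K B ξ η) :
    IsBiorth (pairFunctional K B w) (pairVector K v) := by
  have h1 := (hp.swap h).pair
  have h2 := (hp.swap h).pair_K
  intro i j
  fin_cases i <;> fin_cases j <;>
    simp [pairFunctional, pairVector, h1, h2, h.K_iso, h.K_left]

theorem isBiorth_quad (hp : IsDualPair L K B x y v w) (h : IsPontryaginSkew L K B ξ η)
    (hx : x ≠ 0) : IsBiorth (quadFunctional K B v w) (quadVector K v w) := by
  have h1 := (hp.swap h).pair
  have h2 := (hp.swap h).pair_K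
  have h3 := hp.pair
  have h4 := hp.pair_K
  have h5 := h.self_eq_zero hx hp.left
  have h6 := h.self_eq_zero (neg_ne_zero.mpr hx) hp.right
  intro i j
  fin_cases i <;> fin_cases j <;>
    simp [quadFunctional, quadVector, h1, h2, h3, h4, h5, h6, h.K_iso, h.K_left, h.K_self]

theorem comm_pair (hp : IsDualPair L K B x y v w) (h : IsPontryaginSkew L K B ξ η) (a : H) :
    L (biorthProj (pairFunctional K B w) (pairVector K v) a) =
      biorthProj (pairFunctional K B w) (pairVector K v) (L a) := by
  have e1 : B w (L a) = x * B w a - y * B (K w) a := by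
    have := h.skew w a
    rw [hp.right] at this
    simp only [map_add, map_smul, add_apply, smul_apply, smul_eq_mul] at this
    linarith
  have e2 : B (K w) (L a) = x * B (K w) a + y * B w a := by
    have := h.skew (K w) a
    rw [h.comm, hp.right] at this
    simp only [map_add, map_smul, add_apply, smul_apply, h.K_sq, map_neg, neg_apply,
      smul_eq_mul] at this
    linarith
  simp only [biorthProj_pair, map_add, map_smul, h.comm, hp.left, e1, e2, h.K_sq]
  module

theorem comm_quad (hp : IsDualPair L K B x y v w) (h : IsPontryaginSkew L K B ξ η) (a : H) :
    L (biorthProj (quadFunctional K B v w) (quadVector K v w) a) =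
      biorthProj (quadFunctional K B v w) (quadVector K v w) (L a) := by
  rw [biorthProj_quad, biorthProj_quad, map_add, hp.comm_pair h, (hp.swap h).comm_pair h]

/-- A vector annihilated by `(A - z)(A - z̄)`, `A = Γ L`, has no component along the eigenvector `v`
unless the real part of `z` is the one of its eigenvalue. -/
theorem pairing_eq_zero_of_quadShift (hp : IsDualPair L K B x y v w)
    (h : IsPontryaginSkew L K B ξ η) {Γ : ℝ} (hΓ : Γ ≠ 0) {z : ℂ} (hz : z.re ≠ Γ * x) {a : H}
    (ha : quadShift (Γ • L) z a = 0) : B w a = 0 ∧ B (K w) a = 0 := by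
  have hz' : z.re / Γ ≠ x := by
    rwa [Ne, div_eq_iff hΓ, mul_comm]
  rw [h.quadShift_smul hΓ, smul_apply, smul_eq_zero_iff_right (pow_ne_zero 2 hΓ)] at ha
  have ha' : shiftOp L K (z.re / Γ) (z.im / Γ) (shiftOp L K (z.re / Γ) (-(z.im / Γ)) a) = 0 := ha
  have h1 := h.pairing_eq_zero hp.right hz' (by rw [ha', map_zero]) (by rw [ha', map_zero])
  exact h.pairing_eq_zero hp.right hz' h1.1 h1.2

/-- On the common kernel of the four functionals there is no spectrum off the imaginary axis. -/
theorem eq_zero_of_shiftOp (hp : IsDualPair L K B x y v w) (h : IsPontryaginSkew L K B ξ η)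
    (hx : x ≠ 0) {s t : ℝ} (hs : s ≠ 0) {a : H} (ha : shiftOp L K s t a = 0) (h1 : B v a = 0)
    (h2 : B (K v) a = 0) (h3 : B w a = 0) (h4 : B (K w) a = 0) : a = 0 := by
  have hL : L a = s • a + t • K a := by
    rw [shiftOp_apply, sub_sub, sub_eq_zero] at ha
    exact ha
  refine h.eq_zero_of_orthogonal (e := v + w) ?_ ?_ ?_ (h.self_eq_zero hs hL).ge
  · simp only [map_add, add_apply, hp.pair, (hp.swap h).pair, h.self_eq_zero hx hp.left,
      h.self_eq_zero (neg_ne_zero.mpr hx) hp.right]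
    norm_num
  · simp [h1, h3]
  · simp [h2, h4]

theorem eq_zero_of_quadShift (hp : IsDualPair L K B x y v w) (h : IsPontryaginSkew L K B ξ η)
    (hx : x ≠ 0) {Γ : ℝ} (hΓ : Γ ≠ 0) {z : ℂ} (hz : z.re ≠ 0) {a : H}
    (ha : quadShift (Γ • L) z a = 0) (h1 : B v a = 0)
    (h2 : B (K v) a = 0) (h3 : B w a = 0) (h4 : B (K w) a = 0) : a = 0 := by
  have hz' : z.re / Γ ≠ 0 := div_ne_zero hz hΓ
  rw [h.quadShift_smul hΓ, smul_apply, smul_eq_zero_iff_right (pow_ne_zero 2 hΓ)] at ha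
  have ha' : shiftOp L K (z.re / Γ) (z.im / Γ) (shiftOp L K (z.re / Γ) (-(z.im / Γ)) a) = 0 := ha
  have key : ∀ {x y : ℝ} {v w : H}, IsDualPair L K B x y v w → B w a = 0 → B (K w) a = 0 →
      ∀ t, B w (shiftOp L K (z.re / Γ) t a) = 0 ∧ B (K w) (shiftOp L K (z.re / Γ) t a) = 0 := by
    intro x y v w hp h3 h4 t
    have e := hp.comm_pair h a
    rw [biorthProj_pair, biorthProj_pair, h3, h4] at e
    have e0 : biorthProj (pairFunctional K B w) (pairVector K v) (L a) = 0 := by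
      rw [biorthProj_pair, ← e]
      simp
    have e1 := ((hp.isBiorth_pair h).biorthProj_eq_zero_iff _).mp e0
    have e2 : B w (L a) = 0 := e1 0
    have e3 : B (K w) (L a) = 0 := e1 1
    have e4 : B w (K a) = 0 := by rw [← neg_eq_zero, ← h.K_left, h4]
    simp [shiftOp_apply, e2, e3, e4, h3, h4, h.K_iso]
  have k1 := key hp h3 h4 (-(z.im / Γ))
  have k2 := key (hp.swap h) h1 h2 (-(z.im / Γ))
  exact hp.eq_zero_of_shiftOp h hx hz'
    (hp.eq_zero_of_shiftOp h hx hz' ha' k2.1 k2.2 k1.1 k1.2) h1 h2 h3 h4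

end IsDualPair

/-- The index-zero property of the quadratic factors, from the one of the linear factors. -/
theorem isUnitAddCompact_quadShift (h : IsPontryaginSkew L K B ξ η)
    (hF : ∀ s t : ℝ, s ≠ 0 → IsUnitAddCompact (shiftOp L K s t)) {Γ : ℝ} (hΓ : Γ ≠ 0) {z : ℂ}
    (hz : z.re ≠ 0) : IsUnitAddCompact (quadShift (Γ • L) z) := by
  rw [h.quadShift_smul hΓ]
  have hz' : z.re / Γ ≠ 0 := div_ne_zero hz hΓ
  exact ((hF _ _ hz').mul (hF _ _ hz')).smul (pow_ne_zero 2 hΓ)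

section Manifolds

variable [CompleteSpace H] {x y : ℝ} {v w : H} {q : H → ℝ} {f : ℝ × H → ℝ × H}

/-- The manifold on which the components along the eigenvectors with `Γ Re λ < 0` vanish. -/
theorem isCenterUnstableManifold (h : IsPontryaginSkew L K B ξ η)
    (hp : IsDualPair L K B x y v w) (hx : 0 < x)
    (hF : ∀ s t : ℝ, s ≠ 0 → IsUnitAddCompact (shiftOp L K s t))
    (hf : ∀ w, f w = (q w.2, w.1 • L w.2)) (hq0 : q 0 = 0)
    (hq : HasFDerivAt q (0 : H →L[ℝ] ℝ) 0) :
    IsCenterUnstableManifold f {w | ∃ Γ : ℝ, Γ ≠ 0 ∧ w = (Γ, 0)} 2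
      (signedKernel (biorthProj (pairFunctional K B v) (pairVector K w))
        (biorthProj (pairFunctional K B w) (pairVector K v))) := by
  have hs := hp.swap h
  refine isInvariantManifoldOf_signedKernel hf hq0 hq (by simp) (hs.isBiorth_pair h)
    (hp.isBiorth_pair h) (hs.comm_pair h) (hp.comm_pair h) ?_ ?_ ?_ ?_ ?_
  · intro Γ hΓ z hz
    have hz : z.re < 0 := not_le.mp hz
    exact isUnitAddCompact_quadShift h hF hΓ hz.ne
  · intro Γ hΓ z hz a ha hqa
    have hz : z.re < 0 := not_le.mp hz
    have h1 := ((hs.isBiorth_pair h).biorthProj_eq_zero_iff a).mp ha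
    have h2 := hp.pairing_eq_zero_of_quadShift h hΓ.ne' (by nlinarith [mul_pos hΓ hx]) hqa
    exact hp.eq_zero_of_quadShift h hx.ne' hΓ.ne' hz.ne hqa (h1 0) (h1 1) h2.1 h2.2
  · intro Γ hΓ z hz a ha hqa
    have hz : 0 ≤ z.re := hz
    have h2 := hs.pairing_eq_zero_of_quadShift h hΓ.ne' (by nlinarith [mul_pos hΓ hx]) hqa
    rw [← ha, biorthProj_pair, h2.1, h2.2]
    simp
  · intro Γ hΓ z hz a ha hqa
    have hz : z.re < 0 := not_le.mp hz
    have h1 := ((hp.isBiorth_pair h).biorthProj_eq_zero_iff a).mp ha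
    have h2 := hs.pairing_eq_zero_of_quadShift h hΓ.ne
      (by nlinarith [mul_neg_of_neg_of_pos hΓ hx]) hqa
    exact hp.eq_zero_of_quadShift h hx.ne' hΓ.ne hz.ne hqa h2.1 h2.2 (h1 0) (h1 1)
  · intro Γ hΓ z hz a ha hqa
    have hz : 0 ≤ z.re := hz
    have h2 := hp.pairing_eq_zero_of_quadShift h hΓ.ne
      (by nlinarith [mul_neg_of_neg_of_pos hΓ hx]) hqa
    rw [← ha, biorthProj_pair, h2.1, h2.2]
    simp

/-- The manifold on which the components along the eigenvectors with `Γ Re λ > 0` vanish. -/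
theorem isCenterStableManifold (h : IsPontryaginSkew L K B ξ η)
    (hp : IsDualPair L K B x y v w) (hx : 0 < x)
    (hF : ∀ s t : ℝ, s ≠ 0 → IsUnitAddCompact (shiftOp L K s t))
    (hf : ∀ w, f w = (q w.2, w.1 • L w.2)) (hq0 : q 0 = 0)
    (hq : HasFDerivAt q (0 : H →L[ℝ] ℝ) 0) :
    IsCenterStableManifold f {w | ∃ Γ : ℝ, Γ ≠ 0 ∧ w = (Γ, 0)} 2
      (signedKernel (biorthProj (pairFunctional K B w) (pairVector K v))
        (biorthProj (pairFunctional K B v) (pairVector K w))) := by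
  have hs := hp.swap h
  refine isInvariantManifoldOf_signedKernel hf hq0 hq (by simp) (hp.isBiorth_pair h)
    (hs.isBiorth_pair h) (hp.comm_pair h) (hs.comm_pair h) ?_ ?_ ?_ ?_ ?_
  · intro Γ hΓ z hz
    have hz : 0 < z.re := not_le.mp hz
    exact isUnitAddCompact_quadShift h hF hΓ hz.ne'
  · intro Γ hΓ z hz a ha hqa
    have hz : 0 < z.re := not_le.mp hz
    have h1 := ((hp.isBiorth_pair h).biorthProj_eq_zero_iff a).mp ha
    have h2 := hs.pairing_eq_zero_of_quadShift h hΓ.ne' (by nlinarith [mul_pos hΓ hx]) hqa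
    exact hp.eq_zero_of_quadShift h hx.ne' hΓ.ne' hz.ne' hqa h2.1 h2.2 (h1 0) (h1 1)
  · intro Γ hΓ z hz a ha hqa
    have hz : z.re ≤ 0 := hz
    have h2 := hp.pairing_eq_zero_of_quadShift h hΓ.ne' (by nlinarith [mul_pos hΓ hx]) hqa
    rw [← ha, biorthProj_pair, h2.1, h2.2]
    simp
  · intro Γ hΓ z hz a ha hqa
    have hz : 0 < z.re := not_le.mp hz
    have h1 := ((hs.isBiorth_pair h).biorthProj_eq_zero_iff a).mp ha
    have h2 := hp.pairing_eq_zero_of_quadShift h hΓ.ne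
      (by nlinarith [mul_neg_of_neg_of_pos hΓ hx]) hqa
    exact hp.eq_zero_of_quadShift h hx.ne' hΓ.ne hz.ne' hqa (h1 0) (h1 1) h2.1 h2.2
  · intro Γ hΓ z hz a ha hqa
    have hz : z.re ≤ 0 := hz
    have h2 := hs.pairing_eq_zero_of_quadShift h hΓ.ne
      (by nlinarith [mul_neg_of_neg_of_pos hΓ hx]) hqa
    rw [← ha, biorthProj_pair, h2.1, h2.2]
    simp

/-- The manifold on which all components along the hyperbolic eigenvectors vanish. -/
theorem isCenterManifold (h : IsPontryaginSkew L K B ξ η)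
    (hp : IsDualPair L K B x y v w) (hx : 0 < x)
    (hF : ∀ s t : ℝ, s ≠ 0 → IsUnitAddCompact (shiftOp L K s t))
    (hf : ∀ w, f w = (q w.2, w.1 • L w.2)) (hq0 : q 0 = 0)
    (hq : HasFDerivAt q (0 : H →L[ℝ] ℝ) 0) :
    IsCenterManifold f {w | ∃ Γ : ℝ, Γ ≠ 0 ∧ w = (Γ, 0)} 4
      (signedKernel (biorthProj (quadFunctional K B v w) (quadVector K v w))
        (biorthProj (quadFunctional K B v w) (quadVector K v w))) := by
  have hs := hp.swap h
  have hb := hp.isBiorth_quad h hx.ne'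
  have hker : ∀ Γ : ℝ, Γ ≠ 0 → ∀ z ∉ {z : ℂ | z.re = 0}, ∀ a,
      biorthProj (quadFunctional K B v w) (quadVector K v w) a = 0 →
      quadShift (Γ • L) z a = 0 → a = 0 := by
    intro Γ hΓ z hz a ha hqa
    have h1 := (hb.biorthProj_eq_zero_iff a).mp ha
    exact hp.eq_zero_of_quadShift h hx.ne' hΓ hz hqa (h1 2) (h1 3) (h1 0) (h1 1)
  have hrange : ∀ Γ : ℝ, Γ ≠ 0 → ∀ z ∈ {z : ℂ | z.re = 0}, ∀ a,
      biorthProj (quadFunctional K B v w) (quadVector K v w) a = a →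
      quadShift (Γ • L) z a = 0 → a = 0 := by
    intro Γ hΓ z hz a ha hqa
    have hz : z.re = 0 := hz
    have h2 := hp.pairing_eq_zero_of_quadShift h hΓ
      (by rw [hz]; exact (mul_ne_zero hΓ hx.ne').symm) hqa
    have h3 := hs.pairing_eq_zero_of_quadShift h hΓ
      (by rw [hz]; exact (mul_ne_zero hΓ (neg_ne_zero.mpr hx.ne')).symm) hqa
    rw [← ha, biorthProj_quad, biorthProj_pair, biorthProj_pair, h2.1, h2.2, h3.1, h3.2]
    simp
  exact isInvariantManifoldOf_signedKernel hf hq0 hq (by simp) hb hb (hp.comm_quad h)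
    (hp.comm_quad h) (fun Γ hΓ z hz => isUnitAddCompact_quadShift h hF hΓ hz)
    (fun Γ hΓ => hker Γ hΓ.ne') (fun Γ hΓ => hrange Γ hΓ.ne') (fun Γ hΓ => hker Γ hΓ.ne)
    (fun Γ hΓ => hrange Γ hΓ.ne)

end Manifolds

end Krein

/-! ### Weighted shifts on `ℓ²(ℤ)` -/

section WeightedShifts

/-- The real Hilbert space `ℓ²(ℤ)`. -/
abbrev EllTwo : Type := lp (fun _ : ℤ => ℝ) 2

theorem EllTwo.summable_sq (u : EllTwo) : Summable fun n => u n ^ 2 := by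
  have h := (memℓp_gen_iff (by norm_num)).mp (lp.memℓp u)
  simpa using h

theorem EllTwo.norm_sq (u : EllTwo) : ‖u‖ ^ 2 = ∑' n, u n ^ 2 := by
  have h := lp.norm_rpow_eq_tsum (p := 2) (by norm_num) u
  simpa using h

theorem memℓp_two_of_summable_sq {u : ℤ → ℝ} (h : Summable fun n => u n ^ 2) : Memℓp u 2 := by
  rw [memℓp_gen_iff (by norm_num)]
  simpa using h

theorem sq_mul_comp_le {m : ℤ → ℝ} {C : ℝ} (hm : ∀ n, |m n| ≤ C) (e : ℤ ≃ ℤ) (u : ℤ → ℝ) (n : ℤ) :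
    (m n * u (e n)) ^ 2 ≤ C ^ 2 * u (e n) ^ 2 := by
  rw [mul_pow]
  refine mul_le_mul_of_nonneg_right ?_ (sq_nonneg _)
  rw [← sq_abs]
  exact pow_le_pow_left₀ (abs_nonneg _) (hm n) 2

/-- The weighted composition operator `(u n) ↦ (m n * u (e n))`, for a weight bounded by `C`. -/
noncomputable def weightedShift (m : ℤ → ℝ) (e : ℤ ≃ ℤ) (C : ℝ) (hm : ∀ n, |m n| ≤ C) :
    EllTwo →L[ℝ] EllTwo :=
  LinearMap.mkContinuous
    { toFun := fun u => ⟨fun n => m n * u (e n), memℓp_two_of_summable_sq <|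
        Summable.of_nonneg_of_le (fun _ => sq_nonneg _) (sq_mul_comp_le hm e u)
          (((e.summable_iff (f := fun n => u n ^ 2)).mpr u.summable_sq).mul_left (C ^ 2))⟩
      map_add' := fun u v => by
        ext n
        exact mul_add _ _ _
      map_smul' := fun c u => by
        ext n
        exact mul_left_comm _ _ _ }
    C (fun u => by
      have hC : 0 ≤ C := (abs_nonneg _).trans (hm 0)
      refine abs_le_of_sq_le_sq' ?_ (by positivity) |>.2
      rw [EllTwo.norm_sq, mul_pow, EllTwo.norm_sq, ← e.tsum_eq (fun n => u n ^ 2), ← tsum_mul_left]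
      have hs := ((e.summable_iff (f := fun n => u n ^ 2)).mpr u.summable_sq).mul_left (C ^ 2)
      exact Summable.tsum_le_tsum (sq_mul_comp_le hm e u)
        (Summable.of_nonneg_of_le (fun _ => sq_nonneg _) (sq_mul_comp_le hm e u) hs) hs)

variable {m m' : ℤ → ℝ} {e : ℤ ≃ ℤ} {C C' : ℝ}

@[simp]
theorem weightedShift_apply (hm : ∀ n, |m n| ≤ C) (u : EllTwo) (n : ℤ) :
    weightedShift m e C hm u n = m n * u (e n) := rfl

theorem norm_weightedShift_le (hm : ∀ n, |m n| ≤ C) : ‖weightedShift m e C hm‖ ≤ C :=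
  LinearMap.mkContinuous_norm_le _ ((abs_nonneg _).trans (hm 0)) _

theorem inner_weightedShift (hm : ∀ n, |m n| ≤ C) (hm' : ∀ n, |m' n| ≤ C')
    (h : ∀ n, m n = m' (e n)) (u v : EllTwo) :
    inner ℝ (weightedShift m e C hm u) v = inner ℝ u (weightedShift m' e.symm C' hm' v) := by
  rw [lp.inner_eq_tsum, lp.inner_eq_tsum,
    ← e.tsum_eq (fun n => inner ℝ (u n) (weightedShift m' e.symm C' hm' v n))]
  refine tsum_congr fun n => ?_
  simp [h]
  ring

/-- A weighted shift is compact if its weight tends to zero, as a norm limit of finite-rank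
operators. -/
theorem isCompactOperator_weightedShift (hm : ∀ n, |m n| ≤ C)
    (h0 : Filter.Tendsto m Filter.cofinite (nhds 0)) :
    IsCompactOperator (weightedShift m e C hm) := by
  classical
  have hsub : ∀ (F : Finset ℤ) (n : ℤ), |if n ∈ F then m n else 0| ≤ C := by
    intro F n
    split_ifs
    · exact hm n
    · simpa using (abs_nonneg _).trans (hm 0)
  have hfin : ∀ F : Finset ℤ, IsCompactOperator
      (weightedShift (fun n => if n ∈ F then m n else 0) e C (hsub F)) := by
    intro F
    have hsum : weightedShift (fun n => if n ∈ F then m n else 0) e C (hsub F) =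
        ∑ n ∈ F, (lp.evalCLM ℝ (fun _ : ℤ => ℝ) 2 (e n)).smulRight (lp.single 2 n (m n)) := by
      ext u k
      rw [weightedShift_apply, sum_apply, lp.coeFn_sum]
      erw [Finset.sum_apply]
      simp only [ContinuousLinearMap.smulRight_apply, lp.coeFn_smul, lp.coeFn_single, Pi.smul_apply,
        Pi.single_apply, smul_eq_mul, mul_ite, mul_zero, Finset.sum_ite_eq, ite_mul, zero_mul]
      exact ite_congr rfl (fun _ => mul_comm _ _) (fun _ => rfl)
    rw [hsum]
    have hmem : ∑ n ∈ F, (lp.evalCLM ℝ (fun _ : ℤ => ℝ) 2 (e n)).smulRight (lp.single 2 n (m n)) ∈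
        compactOperator (RingHom.id ℝ) EllTwo EllTwo :=
      Submodule.sum_mem _ fun n _ =>
        (isCompactOperator_of_locallyCompactSpace_rng
          (ContinuousLinearMap.toSpanSingleton ℝ (lp.single 2 n (m n) : EllTwo))).comp_clm
          (lp.evalCLM ℝ (fun _ : ℤ => ℝ) 2 (e n))
    exact hmem
  have hlim : Filter.Tendsto
      (fun F : Finset ℤ => weightedShift (fun n => if n ∈ F then m n else 0) e C (hsub F))
      Filter.atTop (nhds (weightedShift m e C hm)) := by
    rw [Metric.tendsto_atTop]
    intro ε hε
    have hev : ∀ᶠ n in Filter.cofinite, |m n| < ε / 2 := by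
      have := h0.abs
      rw [abs_zero] at this
      exact this.eventually_lt_const (by linarith)
    refine ⟨(Filter.eventually_cofinite.mp hev).toFinset, fun F hF => ?_⟩
    have hd : ∀ n, |(if n ∈ F then m n else 0) - m n| ≤ ε / 2 := by
      intro n
      split_ifs with hn
      · simpa using (half_pos hε).le
      · rw [zero_sub, abs_neg]
        by_contra hlt
        exact hn (hF (by simpa using fun h => hlt (le_of_lt h)))
    rw [dist_eq_norm]
    have heq : weightedShift (fun n => if n ∈ F then m n else 0) e C (hsub F) -
        weightedShift m e C hm = weightedShift _ e (ε / 2) hd := by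
      ext u n
      exact (sub_mul _ _ _).symm
    rw [heq]
    exact (norm_weightedShift_le hd).trans_lt (by linarith)
  exact isCompactOperator_of_tendsto hlim (Filter.Eventually.of_forall hfin)

/-- A bounded operator with `⟪T u, u⟫ = c ‖u‖²`, `c ≠ 0`, is invertible (Lax-Milgram). -/
theorem isUnit_of_inner_self_eq {V : Type*} [NormedAddCommGroup V] [InnerProductSpace ℝ V]
    [CompleteSpace V] {T : V →L[ℝ] V} {c : ℝ} (hc : c ≠ 0)
    (hT : ∀ u, inner ℝ (T u) u = c * ‖u‖ ^ 2) : IsUnit T := by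
  have key : ∀ (T : V →L[ℝ] V) (c : ℝ), 0 < c → (∀ u, inner ℝ (T u) u = c * ‖u‖ ^ 2) →
      IsUnit T := by
    intro T c hc hT
    have hco : IsCoercive ((innerSL ℝ).comp T) :=
      ⟨c, hc, fun u => by
        change c * ‖u‖ * ‖u‖ ≤ inner ℝ (T u) u
        rw [hT]
        exact le_of_eq (by ring)⟩
    have hTJ : T = (hco.continuousLinearEquivOfBilin : V →L[ℝ] V) := by
      ext u
      refine hco.unique_continuousLinearEquivOfBilin (v := u) (f := T u) fun w => rfl
    rw [hTJ, ContinuousLinearMap.isUnit_iff_bijective]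
    exact hco.continuousLinearEquivOfBilin.bijective
  rcases hc.lt_or_gt with h | h
  · have := key (-T) (-c) (neg_pos.mpr h) (fun u => by simp [hT u])
    simpa using this
  · exact key T c h hT

/-- Index zero is invariant under conjugation. -/
theorem IsUnitAddCompact.conj {X Y : Type*} [NormedAddCommGroup X] [NormedSpace ℝ X]
    [NormedAddCommGroup Y] [NormedSpace ℝ Y] {T : X →L[ℝ] X} (hT : IsUnitAddCompact T)
    (Φ : Y ≃L[ℝ] X) :
    IsUnitAddCompact ((Φ.symm : X →L[ℝ] Y) ∘L T ∘L (Φ : Y →L[ℝ] X)) := by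
  obtain ⟨J, ⟨u, rfl⟩, hC⟩ := hT
  have hinv : ∀ a, (u : X →L[ℝ] X) (((u⁻¹ : (X →L[ℝ] X)ˣ) : X →L[ℝ] X) a) = a := fun a => by
    rw [← mul_apply_eq_comp, Units.mul_inv]; rfl
  have hinv' : ∀ a, ((u⁻¹ : (X →L[ℝ] X)ˣ) : X →L[ℝ] X) ((u : X →L[ℝ] X) a) = a := fun a => by
    rw [← mul_apply_eq_comp, Units.inv_mul]; rfl
  refine ⟨(Φ.symm : X →L[ℝ] Y) ∘L (u : X →L[ℝ] X) ∘L (Φ : Y →L[ℝ] X), ?_, ?_⟩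
  · refine ⟨⟨_, (Φ.symm : X →L[ℝ] Y) ∘L ((u⁻¹ : (X →L[ℝ] X)ˣ) : X →L[ℝ] X) ∘L (Φ : Y →L[ℝ] X),
      ?_, ?_⟩, rfl⟩
    · ext a
      simp [hinv]
    · ext a
      simp [hinv']
  · have h := (hC.comp_clm (Φ : Y →L[ℝ] X)).clm_comp (Φ.symm : X →L[ℝ] Y)
    have e : ⇑((Φ.symm : X →L[ℝ] Y) ∘L T ∘L (Φ : Y →L[ℝ] X) -
        (Φ.symm : X →L[ℝ] Y) ∘L (u : X →L[ℝ] X) ∘L (Φ : Y →L[ℝ] X)) =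
        (Φ.symm : X →L[ℝ] Y) ∘ ((T - u : X →L[ℝ] X) ∘ (Φ : Y →L[ℝ] X)) := by
      funext a
      simp
    rw [e]
    exact h

end WeightedShifts

/-! ### Asymptotics of the coefficients and the weights -/

section Coefficients

theorem lineA_eq (n : ℤ) : lineA n = (1 / 2) * ((waveNormSq (lineMode n))⁻¹ - 1 / 2) := by
  have h3 : waveNormSq modeP = 2 := by norm_num [waveNormSq, modeP]
  simp only [lineA, eulerA, h3]
  simp only [lineMode, modeP, Prod.fst_add, Prod.snd_add, Prod.smul_mk, smul_eq_mul]
  push_cast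
  ring

theorem waveNormSq_lineMode_reflect (n : ℤ) :
    waveNormSq (lineMode (5 - n)) = waveNormSq (lineMode n) := by
  rw [waveNormSq_lineMode, waveNormSq_lineMode]
  push_cast
  ring

theorem lineA_reflect (n : ℤ) : lineA (5 - n) = lineA n := by
  rw [lineA_eq, lineA_eq, waveNormSq_lineMode_reflect]

theorem sobolevWeight_reflect (s : ℝ) (n : ℤ) : sobolevWeight s (5 - n) = sobolevWeight s n := by
  rw [sobolevWeight, sobolevWeight, waveNormSq_lineMode_reflect]

/-- All coefficients but `A₂ = A₃` are negative: only the modes `(-1, 0)` and `(0, 1)` are shorter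
than `p`. -/
theorem lineA_neg {n : ℤ} (h2 : n ≠ 2) (h3 : n ≠ 3) : lineA n < 0 := by
  have h : (2 : ℝ) < waveNormSq (lineMode n) := by
    rw [waveNormSq_lineMode]
    have : (2 : ℤ) < (n - 3) ^ 2 + (n - 2) ^ 2 := by
      rcases lt_or_gt_of_ne h2 with h | h
      · nlinarith
      · have : 4 ≤ n := by omega
        nlinarith
    exact_mod_cast this
  rw [lineA_eq]
  have := inv_lt_inv₀ (by linarith : (0 : ℝ) < waveNormSq (lineMode n)) two_pos |>.mpr h
  linarith

theorem abs_lineA₂_le (n : ℤ) : |lineA₂ (n - 1) n| ≤ 1 := by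
  have h1 := one_le_waveNormSq_lineMode n
  have h2 := one_le_waveNormSq_lineMode (n - 1)
  have h3 := inv_le_one_of_one_le₀ h1
  have h4 := inv_le_one_of_one_le₀ h2
  have h5 : 0 ≤ (waveNormSq (lineMode n))⁻¹ := by positivity
  have h6 : 0 ≤ (waveNormSq (lineMode (n - 1)))⁻¹ := by positivity
  -- the cross product of neighbouring modes is the constant `k̂ × p = -1`
  have h : lineA₂ (n - 1) n =
      (1 / 2) * ((waveNormSq (lineMode (n - 1)))⁻¹ - (waveNormSq (lineMode n))⁻¹) := by
    simp only [lineA₂, eulerA]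
    have : ((lineMode (n - 1)).1 : ℝ) * (lineMode n).2 - ((lineMode (n - 1)).2 : ℝ) * (lineMode n).1
        = -1 := by
      simp only [lineMode, modeP, Prod.fst_add, Prod.snd_add, Prod.smul_mk, smul_eq_mul]
      push_cast
      ring
    rw [this]
    ring
  rw [h, abs_le]
  constructor <;> linarith

theorem tendsto_waveNormSq :
    Filter.Tendsto (fun n : ℤ => waveNormSq (lineMode n)) Filter.cofinite Filter.atTop := by
  have h1 : Filter.Tendsto (fun n : ℤ => |((n - 3 : ℤ) : ℝ)|) Filter.cofinite Filter.atTop := by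
    have h2 : Filter.Tendsto (fun n : ℤ => ‖n‖) Filter.cofinite Filter.atTop := by
      rw [← Filter.cocompact_eq_cofinite]
      exact tendsto_norm_cocompact_atTop
    exact h2.comp (sub_left_injective (b := (3 : ℤ))).tendsto_cofinite
  refine Filter.tendsto_atTop_mono (fun n => ?_) h1
  rw [waveNormSq_lineMode]
  have h : |n - 3| ≤ (n - 3) ^ 2 + (n - 2) ^ 2 := by
    have : |n - 3| ≤ (n - 3) ^ 2 := by
      rw [← sq_abs]
      exact Int.le_self_sq _
    nlinarith [sq_nonneg (n - 2)]
  exact_mod_cast h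

theorem tendsto_lineA : Filter.Tendsto lineA Filter.cofinite (nhds (-(1 / 4))) := by
  have h := ((tendsto_waveNormSq.inv_tendsto_atTop).sub_const (1 / 2)).const_mul (1 / 2)
  refine (h.congr fun n => (lineA_eq n).symm).trans_eq ?_
  norm_num

theorem tendsto_waveNormSq_div {j : ℤ} (hj : j = 1 ∨ j = -1) :
    Filter.Tendsto (fun n : ℤ => waveNormSq (lineMode n) / waveNormSq (lineMode (n + j)))
      Filter.cofinite (nhds 1) := by
  have hshift : Filter.Tendsto (fun n : ℤ => waveNormSq (lineMode (n + j))) Filter.cofinite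
      Filter.atTop := tendsto_waveNormSq.comp (add_left_injective j).tendsto_cofinite
  have h0 : Filter.Tendsto (fun n : ℤ => 4 * (√(waveNormSq (lineMode (n + j))))⁻¹)
      Filter.cofinite (nhds 0) := by
    have := ((Real.tendsto_sqrt_atTop.comp hshift).inv_tendsto_atTop).const_mul 4
    rw [mul_zero] at this
    exact this
  rw [tendsto_iff_norm_sub_tendsto_zero]
  refine squeeze_zero (fun _ => norm_nonneg _) (fun n => ?_) h0
  have hpos : 0 < waveNormSq (lineMode (n + j)) :=
    lt_of_lt_of_le one_pos (one_le_waveNormSq_lineMode _)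
  have hsq := Real.sqrt_pos.mpr hpos
  have hdiff : (waveNormSq (lineMode n) - waveNormSq (lineMode (n + j))) ^ 2 ≤
      (4 * √(waveNormSq (lineMode (n + j)))) ^ 2 := by
    rw [mul_pow, Real.sq_sqrt hpos.le, waveNormSq_lineMode, waveNormSq_lineMode]
    rcases hj with rfl | rfl
    · push_cast
      nlinarith [sq_nonneg ((n : ℝ) - 1)]
    · push_cast
      nlinarith [sq_nonneg ((n : ℝ) - 4)]
  have habs := abs_le_of_sq_le_sq hdiff (by positivity)
  rw [Real.norm_eq_abs, div_sub_one hpos.ne', abs_div, abs_of_pos hpos, div_le_iff₀ hpos]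
  refine habs.trans (le_of_eq ?_)
  nth_rewrite 3 [← Real.mul_self_sqrt hpos.le]
  field_simp

theorem tendsto_sobolevWeight_div (s : ℝ) {j : ℤ} (hj : j = 1 ∨ j = -1) :
    Filter.Tendsto (fun n : ℤ => sobolevWeight s n / sobolevWeight s (n + j))
      Filter.cofinite (nhds 1) := by
  have h := (tendsto_waveNormSq_div hj).rpow_const (p := s / 2) (Or.inl one_ne_zero)
  rw [Real.one_rpow] at h
  refine h.congr fun n => ?_
  rw [Real.div_rpow (zero_le_one.trans (one_le_waveNormSq_lineMode _))
    (zero_le_one.trans (one_le_waveNormSq_lineMode _))]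
  rfl

end Coefficients

/-! ### The linearized operator on `H^s` -/

noncomputable section LineOperator

/-- The isometry `(a n) ↦ (|k̂ + n p|^s a n)` of `H^s` onto `ℓ²`. -/
def lineEquiv (s : ℝ) : LineSobolev s ≃ₗᵢ[ℝ] EllTwo where
  toLinearEquiv := LinearEquiv.ofBijective (LineSobolev.toEll2 s)
    ⟨LineSobolev.toEll2_injective s, fun u => by
      have h : (fun n => sobolevWeight s n * (u n / sobolevWeight s n)) = u := by
        funext n
        rw [mul_div_cancel₀ _ (sobolevWeight_pos s n).ne']
      refine ⟨⟨fun n => u n / sobolevWeight s n, ?_⟩, ?_⟩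
      · change Memℓp _ 2
        rw [h]
        exact lp.memℓp u
      · exact Subtype.ext h⟩
  norm_map' _ := rfl

variable {s : ℝ}

instance : CompleteSpace (LineSobolev s) :=
  (lineEquiv s).toIsometryEquiv.completeSpace

@[ext]
theorem LineSobolev.ext {a b : LineSobolev s} (h : ∀ n, a.coeff n = b.coeff n) : a = b :=
  Subtype.ext (funext h)

theorem lineEquiv_apply (a : LineSobolev s) (n : ℤ) :
    lineEquiv s a n = sobolevWeight s n * a.coeff n := rfl

theorem coeff_lineEquiv_symm (u : EllTwo) (n : ℤ) :
    ((lineEquiv s).symm u).coeff n = u n / sobolevWeight s n := by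
  rw [eq_div_iff (sobolevWeight_pos s n).ne', mul_comm, ← lineEquiv_apply,
    LinearIsometryEquiv.apply_symm_apply]

@[simp] theorem LineSobolev.coeff_add (a b : LineSobolev s) (n : ℤ) :
    (a + b).coeff n = a.coeff n + b.coeff n := rfl

@[simp] theorem LineSobolev.coeff_smul (c : ℝ) (a : LineSobolev s) (n : ℤ) :
    (c • a).coeff n = c * a.coeff n := rfl

@[simp] theorem LineSobolev.coeff_neg (a : LineSobolev s) (n : ℤ) :
    (-a).coeff n = -a.coeff n := rfl

@[simp] theorem LineSobolev.coeff_zero (n : ℤ) : (0 : LineSobolev s).coeff n = 0 := rfl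

/-- An operator on `ℓ²`, transported to `H^s`. -/
def lineConj (s : ℝ) (T : EllTwo →L[ℝ] EllTwo) : LineSobolev s →L[ℝ] LineSobolev s :=
  ((lineEquiv s).toContinuousLinearEquiv.symm : EllTwo →L[ℝ] LineSobolev s) ∘L T ∘L
    ((lineEquiv s).toContinuousLinearEquiv : LineSobolev s →L[ℝ] EllTwo)

theorem coeff_lineConj (T : EllTwo →L[ℝ] EllTwo) (a : LineSobolev s) (n : ℤ) :
    (lineConj s T a).coeff n = T (lineEquiv s a) n / sobolevWeight s n :=
  coeff_lineEquiv_symm _ n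

theorem abs_shiftWeight_le (s : ℝ) {j : ℤ} (hj : j = 1 ∨ j = -1) (n : ℤ) :
    |lineA (n + j) * (sobolevWeight s n / sobolevWeight s (n + j))| ≤ 6 ^ (|s| / 2) := by
  have hw := sobolevWeight_le s (m := n + j) (n := n) (by omega)
  have h0 := sobolevWeight_pos s n
  have h1 := sobolevWeight_pos s (n + j)
  rw [abs_mul, abs_of_pos (div_pos h0 h1)]
  calc |lineA (n + j)| * (sobolevWeight s n / sobolevWeight s (n + j))
      ≤ 1 * (sobolevWeight s n / sobolevWeight s (n + j)) := by
        gcongr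
        exact abs_lineA_le _
    _ ≤ 6 ^ (|s| / 2) := by rwa [one_mul, div_le_iff₀ h1]

/-- The operator `(a n) ↦ (A_{n+j} a_{n+j})` for `j = ±1`, in the coordinates of `ℓ²`. -/
def ellShift (s : ℝ) (j : ℤ) (hj : j = 1 ∨ j = -1) : EllTwo →L[ℝ] EllTwo :=
  weightedShift (fun n => lineA (n + j) * (sobolevWeight s n / sobolevWeight s (n + j)))
    (Equiv.addRight j) (6 ^ (|s| / 2)) (abs_shiftWeight_le s hj)

/-- The linearization `(L a)_n = A_{n-1} a_{n-1} - A_{n+1} a_{n+1}` for `Γ = 1`. -/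
def lineL (s : ℝ) : LineSobolev s →L[ℝ] LineSobolev s :=
  lineConj s (ellShift s (-1) (Or.inr rfl) - ellShift s 1 (Or.inl rfl))

theorem coeff_lineL (a : LineSobolev s) (n : ℤ) :
    (lineL s a).coeff n = lineA (n - 1) * a.coeff (n - 1) - lineA (n + 1) * a.coeff (n + 1) := by
  rw [lineL, coeff_lineConj]
  have h0 := (sobolevWeight_pos s n).ne'
  have h1 := (sobolevWeight_pos s (n + 1)).ne'
  have h2 := (sobolevWeight_pos s (n - 1)).ne'
  change (lineA (n + -1) * (sobolevWeight s n / sobolevWeight s (n + -1)) *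
    (sobolevWeight s (n + -1) * a.coeff (n + -1)) -
    lineA (n + 1) * (sobolevWeight s n / sobolevWeight s (n + 1)) *
    (sobolevWeight s (n + 1) * a.coeff (n + 1))) / sobolevWeight s n = _
  rw [← sub_eq_add_neg]
  field_simp

theorem abs_neg_one_zpow_le (n : ℤ) : |(-1 : ℝ) ^ n| ≤ 1 := by
  rw [abs_zpow, abs_neg, abs_one, one_zpow]

theorem neg_one_zpow_mul_self (n : ℤ) : (-1 : ℝ) ^ n * (-1 : ℝ) ^ n = 1 := by
  rw [← mul_zpow]
  norm_num

theorem neg_one_zpow_reflect (n : ℤ) : (-1 : ℝ) ^ (5 - n) = -(-1 : ℝ) ^ n := by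
  rw [zpow_sub₀ (by norm_num), div_eq_iff (zpow_ne_zero _ (by norm_num)), neg_mul,
    neg_one_zpow_mul_self]
  norm_num

/-- The operator `(u n) ↦ ((-1)^n u_{5-n})` on `ℓ²`. -/
def ellK : EllTwo →L[ℝ] EllTwo :=
  weightedShift (fun n => (-1 : ℝ) ^ n) (Equiv.subLeft 5) 1 abs_neg_one_zpow_le

theorem ellK_apply (u : EllTwo) (n : ℤ) : ellK u n = (-1 : ℝ) ^ n * u (5 - n) := rfl

theorem inner_ellK (u v : EllTwo) : inner ℝ (ellK u) (ellK v) = inner ℝ u v := by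
  rw [lp.inner_eq_tsum, lp.inner_eq_tsum, ← (Equiv.subLeft (5 : ℤ)).tsum_eq
    (fun n => inner ℝ (u n) (v n))]
  refine tsum_congr fun n => ?_
  have := neg_one_zpow_mul_self n
  simp only [ellK_apply, Equiv.subLeft_apply, RCLike.inner_apply, conj_trivial]
  linear_combination v (5 - n) * u (5 - n) * this

theorem ellK_ellK (u : EllTwo) : ellK (ellK u) = -u := by
  ext n
  rw [ellK_apply, ellK_apply, neg_one_zpow_reflect, sub_sub_cancel]
  have := neg_one_zpow_mul_self n
  simp only [lp.coeFn_neg, Pi.neg_apply]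
  linear_combination -u n * this

theorem inner_ellK_self (u : EllTwo) : inner ℝ (ellK u) u = 0 := by
  have h := inner_ellK (ellK u) u
  rw [ellK_ellK, inner_neg_left, real_inner_comm] at h
  linarith

/-- The complex structure `(K a)_n = (-1)^n a_{5-n}` on `H^s`. -/
def lineK (s : ℝ) : LineSobolev s →L[ℝ] LineSobolev s := lineConj s ellK

theorem coeff_lineK (a : LineSobolev s) (n : ℤ) :
    (lineK s a).coeff n = (-1 : ℝ) ^ n * a.coeff (5 - n) := by
  rw [lineK, coeff_lineConj, ellK_apply, lineEquiv_apply, sobolevWeight_reflect]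
  have h0 := (sobolevWeight_pos s n).ne'
  field_simp

theorem abs_one_le (_ : ℤ) : |(1 : ℝ)| ≤ 1 := by simp

/-- The translations `(u n) ↦ (u (n + j))` of `ℓ²`. -/
def ellTranslate (j : ℤ) : EllTwo →L[ℝ] EllTwo :=
  weightedShift (fun _ => 1) (Equiv.addRight j) 1 abs_one_le

theorem ellTranslate_apply (j : ℤ) (u : EllTwo) (n : ℤ) : ellTranslate j u n = u (n + j) :=
  one_mul _

theorem inner_ellTranslate (j : ℤ) (u v : EllTwo) :
    inner ℝ (ellTranslate j u) v = inner ℝ u (ellTranslate (-j) v) := by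
  have h := inner_weightedShift (e := Equiv.addRight j) abs_one_le abs_one_le (fun _ => rfl) u v
  rw [show (Equiv.addRight j).symm = Equiv.addRight (-j) from Equiv.ext fun n => rfl] at h
  exact h

/-- The difference of the two unit translations is skew. -/
theorem inner_ellTranslate_sub (u v : EllTwo) :
    inner ℝ ((ellTranslate (-1) - ellTranslate 1) u) v =
      -inner ℝ u ((ellTranslate (-1) - ellTranslate 1) v) := by
  simp only [sub_apply, inner_sub_left, inner_sub_right, inner_ellTranslate, neg_neg]
  ring

/-- Off the imaginary axis, `L - (x + y K)` is a compact perturbation of the same operator with the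
constant coefficient `-1/4`, which is skew up to the real part `x`. -/
theorem isUnitAddCompact_shiftOp_line {x : ℝ} (hx : x ≠ 0) (y : ℝ) :
    IsUnitAddCompact (shiftOp (lineL s) (lineK s) x y) := by
  set J : EllTwo →L[ℝ] EllTwo :=
    (-(1 / 4) : ℝ) • (ellTranslate (-1) - ellTranslate 1) - x • 1 - y • ellK with hJ
  have hJu : IsUnit J := by
    refine isUnit_of_inner_self_eq (neg_ne_zero.mpr hx) fun u => ?_
    have h1 : inner ℝ ((ellTranslate (-1) - ellTranslate 1) u) u = 0 := by
      have := inner_ellTranslate_sub u u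
      rw [real_inner_comm] at this
      linarith [real_inner_comm u ((ellTranslate (-1) - ellTranslate 1) u)]
    change inner ℝ ((-(1 / 4) : ℝ) • ((ellTranslate (-1) - ellTranslate 1) u) - x • u -
      y • ellK u) u = _
    rw [inner_sub_left, inner_sub_left, real_inner_smul_left, real_inner_smul_left,
      real_inner_smul_left, h1, inner_ellK_self, real_inner_self_eq_norm_sq]
    ring
  have hb : ∀ {j : ℤ} (hj : j = 1 ∨ j = -1) (n : ℤ),
      |lineA (n + j) * (sobolevWeight s n / sobolevWeight s (n + j)) - (-(1 / 4))| ≤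
        6 ^ (|s| / 2) + 1 / 4 := fun hj n => by
    refine (abs_sub _ _).trans (add_le_add (abs_shiftWeight_le s hj n) ?_)
    norm_num
  have hC : ∀ {j : ℤ} (hj : j = 1 ∨ j = -1),
      IsCompactOperator (weightedShift _ (Equiv.addRight j) _ (hb hj)) := by
    intro j hj
    refine isCompactOperator_weightedShift _ ?_
    have h1 : Filter.Tendsto (fun n : ℤ => lineA (n + j)) Filter.cofinite (nhds (-(1 / 4))) :=
      tendsto_lineA.comp (add_left_injective j).tendsto_cofinite
    have h2 := (h1.mul (tendsto_sobolevWeight_div s hj)).sub_const (-(1 / 4))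
    rwa [mul_one, sub_self] at h2
  have hT : IsUnitAddCompact (ellShift s (-1) (Or.inr rfl) - ellShift s 1 (Or.inl rfl) -
      x • 1 - y • ellK : EllTwo →L[ℝ] EllTwo) := by
    refine ⟨J, hJu, ?_⟩
    have h := (hC (j := -1) (Or.inr rfl)).sub (hC (j := 1) (Or.inl rfl))
    have e : ⇑(ellShift s (-1) (Or.inr rfl) - ellShift s 1 (Or.inl rfl) - x • 1 - y • ellK - J :
        EllTwo →L[ℝ] EllTwo) = ⇑(weightedShift _ (Equiv.addRight (-1)) _ (hb (Or.inr rfl))) -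
          ⇑(weightedShift _ (Equiv.addRight 1) _ (hb (Or.inl rfl))) := by
      funext u
      ext n
      rw [hJ]
      change lineA (n + -1) * _ * u (n + -1) - lineA (n + 1) * _ * u (n + 1) - x * u n -
        y * ellK u n - (-(1 / 4) * (1 * u (n + -1) - 1 * u (n + 1)) - x * u n - y * ellK u n) =
        (_ - _) * u (n + -1) - (_ - _) * u (n + 1)
      ring
    rw [e]
    exact h
  have h := hT.conj (lineEquiv s).toContinuousLinearEquiv
  have e : shiftOp (lineL s) (lineK s) x y = lineConj s (ellShift s (-1) (Or.inr rfl) -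
      ellShift s 1 (Or.inl rfl) - x • 1 - y • ellK) := by
    ext a : 1
    apply (lineEquiv s).injective
    simp [shiftOp_apply, lineL, lineK, lineConj]
  rw [e]
  exact h

end LineOperator

/-! ### The invariant form and the quadratic part of the field -/

noncomputable section LineForm

variable {s : ℝ}

theorem one_le_sobolevWeight (hs : 0 ≤ s) (n : ℤ) : 1 ≤ sobolevWeight s n :=
  Real.one_le_rpow (one_le_waveNormSq_lineMode n) (by linarith)

theorem abs_inv_sobolevWeight_le (hs : 0 ≤ s) (n : ℤ) : |(sobolevWeight s n)⁻¹| ≤ 1 := by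
  rw [abs_of_pos (inv_pos.mpr (sobolevWeight_pos s n))]
  exact inv_le_one_of_one_le₀ (one_le_sobolevWeight hs n)

/-- The inclusion of `H^s`, `s ≥ 0`, into `ℓ²`. -/
def lineIncl (hs : 0 ≤ s) : LineSobolev s →L[ℝ] EllTwo :=
  weightedShift (fun n => (sobolevWeight s n)⁻¹) (Equiv.refl ℤ) 1 (abs_inv_sobolevWeight_le hs) ∘L
    ((lineEquiv s).toContinuousLinearEquiv : LineSobolev s →L[ℝ] EllTwo)

@[simp]
theorem lineIncl_apply (hs : 0 ≤ s) (a : LineSobolev s) (n : ℤ) :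
    lineIncl hs a n = a.coeff n :=
  inv_mul_cancel_left₀ (sobolevWeight_pos s n).ne' _

/-- Multiplication by the coefficients `A_n` on `ℓ²`. -/
def ellA : EllTwo →L[ℝ] EllTwo := weightedShift lineA (Equiv.refl ℤ) 1 abs_lineA_le

theorem ellA_apply (u : EllTwo) (n : ℤ) : ellA u n = lineA n * u n := rfl

theorem inner_ellA (u v : EllTwo) : inner ℝ (ellA u) v = inner ℝ u (ellA v) :=
  inner_weightedShift (e := Equiv.refl ℤ) abs_lineA_le abs_lineA_le (fun _ => rfl) u v

theorem ellA_ellK (u : EllTwo) : ellA (ellK u) = ellK (ellA u) := by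
  ext n
  rw [ellA_apply, ellK_apply, ellK_apply, ellA_apply, lineA_reflect]
  ring

/-- The quadratic invariant `∑ A_n a_n b_n` of the linearized equation. -/
def lineForm (hs : 0 ≤ s) : LineSobolev s →L[ℝ] LineSobolev s →L[ℝ] ℝ :=
  (innerSL ℝ).bilinearComp (ellA ∘L lineIncl hs) (lineIncl hs)

theorem lineForm_apply (hs : 0 ≤ s) (a b : LineSobolev s) :
    lineForm hs a b = inner ℝ (ellA (lineIncl hs a)) (lineIncl hs b) := rfl

theorem hasSum_lineForm (hs : 0 ≤ s) (a : LineSobolev s) :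
    HasSum (fun n => lineA n * a.coeff n ^ 2) (lineForm hs a a) := by
  have h := lp.hasSum_inner (𝕜 := ℝ) (ellA (lineIncl hs a)) (lineIncl hs a)
  have e : ∀ n, inner ℝ (ellA (lineIncl hs a) n) (lineIncl hs a n) = lineA n * a.coeff n ^ 2 := by
    intro n
    simp only [ellA_apply, lineIncl_apply, RCLike.inner_apply, conj_trivial]
    ring
  rw [funext e] at h
  exact h

theorem lineIncl_lineL (hs : 0 ≤ s) (a : LineSobolev s) :
    lineIncl hs (lineL s a) = (ellTranslate (-1) - ellTranslate 1) (ellA (lineIncl hs a)) := by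
  ext n
  rw [lineIncl_apply, coeff_lineL]
  change _ = ellTranslate (-1) (ellA (lineIncl hs a)) n - ellTranslate 1 (ellA (lineIncl hs a)) n
  rw [ellTranslate_apply, ellTranslate_apply, ellA_apply, ellA_apply, lineIncl_apply,
    lineIncl_apply, ← sub_eq_add_neg]

theorem lineIncl_lineK (hs : 0 ≤ s) (a : LineSobolev s) :
    lineIncl hs (lineK s a) = ellK (lineIncl hs a) := by
  ext n
  rw [lineIncl_apply, coeff_lineK, ellK_apply, lineIncl_apply]

/-- The coefficient functional `a ↦ a_n`. -/
def lineCoeff (hs : 0 ≤ s) (n : ℤ) : LineSobolev s →L[ℝ] ℝ :=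
  lp.evalCLM ℝ (fun _ : ℤ => ℝ) 2 n ∘L lineIncl hs

theorem lineCoeff_apply (hs : 0 ≤ s) (n : ℤ) (a : LineSobolev s) :
    lineCoeff hs n a = a.coeff n := lineIncl_apply hs a n

/-- The linearized operator is skew for the form `∑ A_n a_n b_n`, whose only positive directions are
the modes `2` and `3`. -/
theorem isPontryaginSkew_line (hs : 0 ≤ s) :
    IsPontryaginSkew (lineL s) (lineK s) (lineForm hs) (lineCoeff hs 3) (lineCoeff hs 2) where
  K_sq a := by
    ext n
    rw [coeff_lineK, coeff_lineK, neg_one_zpow_reflect, sub_sub_cancel, LineSobolev.coeff_neg]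
    linear_combination -a.coeff n * neg_one_zpow_mul_self n
  comm a := by
    ext n
    rw [coeff_lineK, coeff_lineL, coeff_lineL, coeff_lineK, coeff_lineK,
      zpow_sub_one₀ (by norm_num), zpow_add_one₀ (by norm_num),
      show 5 - (n - 1) = 5 - n + 1 by ring, show 5 - (n + 1) = 5 - n - 1 by ring,
      ← lineA_reflect (n - 1), ← lineA_reflect (n + 1),
      show 5 - (n - 1) = 5 - n + 1 by ring, show 5 - (n + 1) = 5 - n - 1 by ring]
    norm_num
    ring
  symm a b := by
    rw [lineForm_apply, lineForm_apply, inner_ellA, real_inner_comm]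
  K_iso a b := by
    rw [lineForm_apply, lineForm_apply, lineIncl_lineK, lineIncl_lineK, ellA_ellK, inner_ellK]
  skew a b := by
    rw [lineForm_apply, lineForm_apply, lineIncl_lineL, lineIncl_lineL, inner_ellA,
      inner_ellTranslate_sub]
  xi_K a := by
    rw [lineCoeff_apply, lineCoeff_apply, coeff_lineK]
    norm_num
  eta_K a := by
    rw [lineCoeff_apply, lineCoeff_apply, coeff_lineK]
    norm_num
  neg a h3 h2 h := by
    rw [lineCoeff_apply] at h3 h2
    have hle : ∀ n, 0 ≤ -(lineA n * a.coeff n ^ 2) := by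
      intro n
      by_cases hn2 : n = 2
      · rw [hn2, h2]; simp
      by_cases hn3 : n = 3
      · rw [hn3, h3]; simp
      have := lineA_neg hn2 hn3
      nlinarith [sq_nonneg (a.coeff n)]
    have hsum := (hasSum_lineForm hs a).neg
    have h0 : -(lineForm hs a a) = 0 :=
      le_antisymm (neg_nonpos.mpr h) (hsum.nonneg hle)
    rw [h0, hasSum_zero_iff_of_nonneg hle] at hsum
    ext n
    have hn := congrFun hsum n
    simp only [Pi.zero_apply, neg_eq_zero, mul_eq_zero, pow_eq_zero_iff two_ne_zero] at hn
    by_cases hn2 : n = 2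
    · rw [hn2, h2]; rfl
    by_cases hn3 : n = 3
    · rw [hn3, h3]; rfl
    exact hn.resolve_left (lineA_neg hn2 hn3).ne

/-- The quadratic form `-∑ A_{n-1,n} a_{n-1} a_n` driving `ω_p`. -/
def lineQuad (a : LineSobolev s) : ℝ :=
  -∑' n : ℤ, lineA₂ (n - 1) n * a.coeff (n - 1) * a.coeff n

theorem lineField_eq (ω : LinePhase s) : lineField s ω = (lineQuad ω.2, ω.1 • lineL s ω.2) := by
  refine Prod.ext rfl ?_
  ext n
  rw [LineSobolev.coeff_smul, coeff_lineL]
  change lineA (n - 1) * ω.1 * ω.2.coeff (n - 1) - lineA (n + 1) * ω.1 * ω.2.coeff (n + 1) = _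
  ring

theorem lineQuad_zero : lineQuad (0 : LineSobolev s) = 0 := by
  simp [lineQuad]

/-- The quadratic form `lineQuad` is bounded, so its derivative at the origin vanishes. -/
theorem hasFDerivAt_lineQuad (hs : 0 ≤ s) :
    HasFDerivAt (lineQuad (s := s)) (0 : LineSobolev s →L[ℝ] ℝ) 0 := by
  set b : LineSobolev s →L[ℝ] LineSobolev s →L[ℝ] ℝ :=
    (innerSL ℝ).bilinearComp (weightedShift (fun n => lineA₂ (n - 1) n) (Equiv.subRight 1) 1
      abs_lineA₂_le ∘L lineIncl hs) (lineIncl hs) with hb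
  have hq : lineQuad (s := s) = fun a => -(b a a) := by
    funext a
    rw [lineQuad]
    refine congrArg Neg.neg ?_
    change _ = inner ℝ (weightedShift _ _ 1 abs_lineA₂_le (lineIncl hs a)) (lineIncl hs a)
    rw [lp.inner_eq_tsum]
    refine tsum_congr fun n => ?_
    simp
    ring
  rw [hq]
  have h := (b.hasFDerivAt_of_bilinear (hasFDerivAt_id (0 : LineSobolev s))
    (hasFDerivAt_id (0 : LineSobolev s))).neg
  refine h.congr_fderiv ?_
  ext a
  simp

/-- The reflection `(a n) ↦ (a_{5-n})` of `H^s`. -/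
def lineR (s : ℝ) : LineSobolev s →L[ℝ] LineSobolev s :=
  lineConj s (weightedShift (fun _ => 1) (Equiv.subLeft 5) 1 abs_one_le)

theorem coeff_lineR (a : LineSobolev s) (n : ℤ) : (lineR s a).coeff n = a.coeff (5 - n) := by
  rw [lineR, coeff_lineConj, weightedShift_apply, Equiv.subLeft_apply, lineEquiv_apply,
    sobolevWeight_reflect]
  have h0 := (sobolevWeight_pos s n).ne'
  field_simp

/-- The reflection reverses time: it maps eigenvectors for `x + y K` to eigenvectors for
`-x + y K`. -/
theorem lineL_lineR {x y : ℝ} {a : LineSobolev s} (ha : lineL s a = x • a + y • lineK s a) :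
    lineL s (lineR s a) = (-x) • lineR s a + y • lineK s (lineR s a) := by
  ext n
  have h := congrArg (fun b => LineSobolev.coeff b (5 - n)) ha
  simp only [coeff_lineL, LineSobolev.coeff_add, LineSobolev.coeff_smul, coeff_lineK,
    neg_one_zpow_reflect, sub_sub_cancel] at h
  simp only [coeff_lineL, LineSobolev.coeff_add, LineSobolev.coeff_smul, coeff_lineK, coeff_lineR,
    sub_sub_cancel]
  rw [← lineA_reflect (n - 1), ← lineA_reflect (n + 1),
    show 5 - (n - 1) = 5 - n + 1 by ring, show 5 - (n + 1) = 5 - n - 1 by ring]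
  linear_combination -h

end LineForm

/-! ### A continued fraction and its fixed point -/

section ContinuedFraction

theorem inv_sub_inv_eq_neg_mul {w w' : ℂ} (hw : w ≠ 0) (hw' : w' ≠ 0) :
    w⁻¹ - w'⁻¹ = -(w⁻¹ * w'⁻¹) * (w - w') := by
  field_simp
  ring

/-- The map `r ↦ 1 / (b μ + r)` on discs: if `c` is nearly the image of the centre `c'` at `μ₀`, the
disc of radius `ρ'` about `c'` is mapped into the disc of radius `ρ` about `c`. -/
theorem inv_mem_disc {μ r c c' μ₀ : ℂ} {b ε ρ' γ η ρ : ℝ} (hb : 0 ≤ b) (hμ : ‖μ - μ₀‖ ≤ ε)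
    (hr : ‖r - c'‖ ≤ ρ') (hc : ‖c‖ ≤ γ) (hη : ‖1 - c * (b * μ₀ + c')‖ ≤ η)
    (hτ : η + γ * (b * ε + ρ') < 1)
    (hρ : γ * (η + γ * (b * ε + ρ')) ≤ ρ * (1 - (η + γ * (b * ε + ρ')))) :
    b * μ + r ≠ 0 ∧ ‖(b * μ + r)⁻¹ - c‖ ≤ ρ := by
  set τ := η + γ * (b * ε + ρ') with hτdef
  set w := (b : ℂ) * μ + r with hw
  have hγ : 0 ≤ γ := (norm_nonneg _).trans hc
  have h1 : ‖1 - c * w‖ ≤ τ := by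
    have e : 1 - c * w = (1 - c * (b * μ₀ + c')) - c * (b * (μ - μ₀) + (r - c')) := by
      rw [hw]
      ring
    rw [e]
    refine (norm_sub_le _ _).trans (add_le_add hη ?_)
    rw [norm_mul]
    refine mul_le_mul hc ((norm_add_le _ _).trans (add_le_add ?_ hr)) (norm_nonneg _) hγ
    rw [norm_mul, Complex.norm_real, Real.norm_of_nonneg hb]
    exact mul_le_mul_of_nonneg_left hμ hb
  have hw0 : w ≠ 0 := by
    intro h
    rw [h, mul_zero, sub_zero, norm_one] at h1
    linarith
  refine ⟨hw0, ?_⟩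
  have h2 : ‖w⁻¹ - c‖ = ‖w⁻¹‖ * ‖1 - c * w‖ := by
    rw [← norm_mul]
    congr 1
    field_simp
  have h3 : ‖w⁻¹‖ ≤ γ + ‖w⁻¹ - c‖ := by
    calc ‖w⁻¹‖ = ‖c + (w⁻¹ - c)‖ := by rw [add_sub_cancel]
      _ ≤ ‖c‖ + ‖w⁻¹ - c‖ := norm_add_le _ _
      _ ≤ γ + ‖w⁻¹ - c‖ := by gcongr
  have h4 : ‖w⁻¹ - c‖ ≤ (γ + ‖w⁻¹ - c‖) * τ := by
    nth_rewrite 1 [h2]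
    exact mul_le_mul h3 h1 (norm_nonneg _) (by positivity)
  nlinarith

theorem norm_le_of_sq_add_sq_le {z : ℂ} {η : ℝ} (hη : 0 ≤ η)
    (h : z.re ^ 2 + z.im ^ 2 ≤ η ^ 2) : ‖z‖ ≤ η := by
  refine abs_le_of_sq_le_sq' ?_ hη |>.2
  rw [Complex.sq_norm, Complex.normSq_apply]
  linarith

/-- One step of a Lipschitz estimate along the continued fraction. -/
theorem norm_inv_sub_inv_le {μ μ' r r' : ℂ} {b γ K K' : ℝ} (hb : 0 ≤ b) (h : b * μ + r ≠ 0)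
    (h' : b * μ' + r' ≠ 0) (hγ : ‖(b * μ + r)⁻¹‖ ≤ γ) (hγ' : ‖(b * μ' + r')⁻¹‖ ≤ γ)
    (hK : ‖r - r'‖ ≤ K * ‖μ - μ'‖) (hKK : γ ^ 2 * (b + K) ≤ K') :
    ‖(b * μ + r)⁻¹ - (b * μ' + r')⁻¹‖ ≤ K' * ‖μ - μ'‖ := by
  have hγ0 : 0 ≤ γ := (norm_nonneg _).trans hγ
  rw [inv_sub_inv_eq_neg_mul h h', norm_mul, norm_neg, norm_mul]
  have h1 : ‖b * μ + r - (b * μ' + r')‖ ≤ (b + K) * ‖μ - μ'‖ := by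
    rw [show b * μ + r - (b * μ' + r') = b * (μ - μ') + (r - r') by ring, add_mul]
    refine (norm_add_le _ _).trans (add_le_add ?_ hK)
    rw [norm_mul, Complex.norm_real, Real.norm_of_nonneg hb]
  calc ‖(b * μ + r)⁻¹‖ * ‖(b * μ' + r')⁻¹‖ * ‖b * μ + r - (b * μ' + r')‖
      ≤ γ * γ * ((b + K) * ‖μ - μ'‖) := by gcongr
    _ = γ ^ 2 * (b + K) * ‖μ - μ'‖ := by ring
    _ ≤ K' * ‖μ - μ'‖ := by gcongr

/-- The approximants of the continued fraction `1 / (b n μ + 1 / (b (n + 1) μ + ⋯))`, truncated by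
the value `c`. -/
noncomputable def truncFraction (b : ℕ → ℝ) (c : ℂ) : ℕ → ℕ → ℂ → ℂ
  | 0, _, _ => c
  | N + 1, n, μ => (b n * μ + truncFraction b c N (n + 1) μ)⁻¹

/-- If all the maps `r ↦ 1 / (b n μ + r)` preserve a disc inside the unit disc, the continued
fraction converges and depends on `μ` in a Lipschitz way. -/
theorem exists_continuedFraction {b : ℕ → ℝ} {D : Set ℂ} {c : ℂ} {ρ γ β K : ℝ}
    (hb0 : ∀ n, 0 ≤ b n) (hbβ : ∀ n, b n ≤ β) (hρ : 0 ≤ ρ)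
    (hmaps : ∀ n, ∀ μ ∈ D, ∀ r, ‖r - c‖ ≤ ρ → b n * μ + r ≠ 0 ∧ ‖(b n * μ + r)⁻¹ - c‖ ≤ ρ)
    (hγ : ‖c‖ + ρ ≤ γ) (hγ1 : γ < 1) (hK : γ ^ 2 * (β + K) ≤ K) (hK0 : 0 ≤ K) :
    ∃ R : ℕ → ℂ → ℂ, (∀ n, ∀ μ ∈ D, ‖R n μ - c‖ ≤ ρ) ∧
      (∀ n, ∀ μ ∈ D, R n μ = (b n * μ + R (n + 1) μ)⁻¹) ∧
      ∀ n, ∀ μ ∈ D, ∀ μ' ∈ D, ‖R n μ - R n μ'‖ ≤ K * ‖μ - μ'‖ := by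
  set f := truncFraction b c with hf
  have hfs : ∀ N n μ, f (N + 1) n μ = (b n * μ + f N (n + 1) μ)⁻¹ := fun _ _ _ => rfl
  have hdisc : ∀ N n, ∀ μ ∈ D, ‖f N n μ - c‖ ≤ ρ := by
    intro N
    induction N with
    | zero => intro n μ _; simpa [hf, truncFraction] using hρ
    | succ N ih => intro n μ hμ; rw [hfs]; exact (hmaps n μ hμ _ (ih _ _ hμ)).2
  have hnorm : ∀ r : ℂ, ‖r - c‖ ≤ ρ → ‖r‖ ≤ γ := by
    intro r hr
    calc ‖r‖ = ‖c + (r - c)‖ := by rw [add_sub_cancel]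
      _ ≤ ‖c‖ + ‖r - c‖ := norm_add_le _ _
      _ ≤ γ := by linarith
  have hγ0 : 0 ≤ γ := (norm_nonneg _).trans (hnorm c (by simpa using hρ))
  have hγ2 : γ ^ 2 < 1 := by nlinarith
  have hstep : ∀ N n, ∀ μ ∈ D, dist (f N n μ) (f (N + 1) n μ) ≤ ρ * (γ ^ 2) ^ N := by
    intro N
    induction N with
    | zero =>
      intro n μ hμ
      rw [dist_comm, dist_eq_norm, pow_zero, mul_one]
      exact hdisc 1 n μ hμ
    | succ N ih =>
      intro n μ hμ
      have h0 := hmaps n μ hμ _ (hdisc N (n + 1) μ hμ)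
      have h1 := hmaps n μ hμ _ (hdisc (N + 1) (n + 1) μ hμ)
      rw [hfs, hfs (N + 1), dist_eq_norm, inv_sub_inv_eq_neg_mul h0.1 h1.1, norm_mul, norm_neg,
        norm_mul, add_sub_add_left_eq_sub, ← dist_eq_norm]
      calc _ ≤ γ * γ * (ρ * (γ ^ 2) ^ N) := by
            gcongr
            · exact hnorm _ h0.2
            · exact hnorm _ h1.2
            · exact ih _ _ hμ
        _ = ρ * (γ ^ 2) ^ (N + 1) := by ring
  have hlim : ∀ n μ, μ ∈ D → ∃ z, Filter.Tendsto (fun N => f N n μ) Filter.atTop (nhds z) :=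
    fun n μ hμ => cauchySeq_tendsto_of_complete
      (cauchySeq_of_le_geometric (γ ^ 2) ρ hγ2 fun N => hstep N n μ hμ)
  choose! R hR using hlim
  have hRdisc : ∀ n, ∀ μ ∈ D, ‖R n μ - c‖ ≤ ρ := fun n μ hμ =>
    le_of_tendsto ((hR n μ hμ).sub_const c).norm (Filter.Eventually.of_forall fun N =>
      hdisc N n μ hμ)
  refine ⟨R, hRdisc, ?_, ?_⟩
  · intro n μ hμ
    have h1 := (hR n μ hμ).comp (Filter.tendsto_add_atTop_nat 1)
    have h2 := ((hR (n + 1) μ hμ).const_add (b n * μ)).inv₀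
      (hmaps n μ hμ _ (hRdisc (n + 1) μ hμ)).1
    exact tendsto_nhds_unique h1 h2
  · have hlip : ∀ N n, ∀ μ ∈ D, ∀ μ' ∈ D, ‖f N n μ - f N n μ'‖ ≤ K * ‖μ - μ'‖ := by
      intro N
      induction N with
      | zero =>
        intro n μ _ μ' _
        simp only [hf, truncFraction, sub_self, norm_zero]
        positivity
      | succ N ih =>
        intro n μ hμ μ' hμ'
        have h0 := hmaps n μ hμ _ (hdisc N (n + 1) μ hμ)
        have h1 := hmaps n μ' hμ' _ (hdisc N (n + 1) μ' hμ')
        refine norm_inv_sub_inv_le (hb0 n) h0.1 h1.1 (hnorm _ h0.2) (hnorm _ h1.2)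
          (ih _ _ hμ _ hμ') (le_trans ?_ hK)
        gcongr
        exact hbβ n
    intro n μ hμ μ' hμ'
    exact le_of_tendsto ((hR n μ hμ).sub (hR n μ' hμ')).norm
      (Filter.Eventually.of_forall fun N => hlip N n μ hμ μ' hμ')

/-- The coefficients `-1 / A_n`, `n = k + 4`. -/
noncomputable def fracCoeff (k : ℕ) : ℝ :=
  4 * (2 * (k : ℝ) ^ 2 + 6 * k + 5) / (2 * (k : ℝ) ^ 2 + 6 * k + 3)

theorem four_le_fracCoeff (k : ℕ) : 4 ≤ fracCoeff k := by
  rw [fracCoeff, le_div_iff₀ (by positivity)]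
  linarith

theorem fracCoeff_le {k : ℕ} (hk : 6 ≤ k) : fracCoeff k ≤ 452 / 111 := by
  have : (6 : ℝ) ≤ k := by exact_mod_cast hk
  rw [fracCoeff, div_le_div_iff₀ (by positivity) (by norm_num)]
  nlinarith

end ContinuedFraction

section FixedPoint

/-- `inv_mem_disc` with the inequalities on complex numbers in coordinates. -/
theorem inv_mem_disc_of_re_im {μ r c c' μ₀ : ℂ} {b ε ρ' γ η ρ : ℝ} (hb : 0 ≤ b)
    (hμ : ‖μ - μ₀‖ ≤ ε) (hr : ‖r - c'‖ ≤ ρ') (hγ : 0 ≤ γ) (hη0 : 0 ≤ η)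
    (hc : c.re ^ 2 + c.im ^ 2 ≤ γ ^ 2)
    (hη : (1 - (c.re * (b * μ₀.re + c'.re) - c.im * (b * μ₀.im + c'.im))) ^ 2 +
      (c.re * (b * μ₀.im + c'.im) + c.im * (b * μ₀.re + c'.re)) ^ 2 ≤ η ^ 2)
    (hτ : η + γ * (b * ε + ρ') < 1)
    (hρ : γ * (η + γ * (b * ε + ρ')) ≤ ρ * (1 - (η + γ * (b * ε + ρ')))) :
    b * μ + r ≠ 0 ∧ ‖(b * μ + r)⁻¹ - c‖ ≤ ρ := by
  refine inv_mem_disc hb hμ hr (norm_le_of_sq_add_sq_le hγ hc) (norm_le_of_sq_add_sq_le hη0 ?_)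
    hτ hρ
  refine (le_of_eq ?_).trans hη
  simp only [Complex.sub_re, Complex.sub_im, Complex.mul_re, Complex.mul_im, Complex.add_re,
    Complex.add_im, Complex.one_re, Complex.one_im, Complex.ofReal_re, Complex.ofReal_im]
  ring

theorem norm_le_of_norm_sub_le {r c : ℂ} {γ ρ : ℝ} (hγ : 0 ≤ γ)
    (hc : c.re ^ 2 + c.im ^ 2 ≤ γ ^ 2) (hr : ‖r - c‖ ≤ ρ) : ‖r‖ ≤ γ + ρ := by
  calc ‖r‖ = ‖c + (r - c)‖ := by rw [add_sub_cancel]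
    _ ≤ ‖c‖ + ‖r - c‖ := norm_add_le _ _
    _ ≤ γ + ρ := add_le_add (norm_le_of_sq_add_sq_le hγ hc) hr

/-- The fixed point `μ` of `μ ↦ (r₀(μ) + i) / 4` to four digits. -/
noncomputable def muApprox : ℂ := ⟨1241/10000, 1759/10000⟩

/-- There are `μ` in the right half-plane and `r` with `r k = 1 / (b k μ + r (k + 1))` inside a
smaller disc than the unit disc, satisfying the boundary condition `4 μ = r 0 + i`.

From index `6` on, the continued fraction stays in one disc; the finitely many levels below are
followed by discs. The map `μ ↦ (r 0 + i) / 4` contracts the disc of radius `1/400` about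
`muApprox`: for the two lowest levels the phases of the derivatives have to be taken into account,
as the bound by absolute values just fails to be a contraction. -/
theorem exists_fraction_fixedPoint : ∃ (μ : ℂ) (r : ℕ → ℂ), 0 < μ.re ∧
    (∀ k, fracCoeff k * μ + r (k + 1) ≠ 0) ∧ (∀ k, r k = (fracCoeff k * μ + r (k + 1))⁻¹) ∧
    (∀ k, ‖r k‖ ≤ 9 / 10) ∧ 4 * μ = r 0 + Complex.I := by
  -- the centre of each disc is close to the value of the continued fraction at `muApprox`; `γ`
  -- bounds the modulus of that centre and `η` the defect of the rounded centres in the recursion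
  have htail : ∀ n, ∀ μ ∈ Metric.closedBall muApprox (1 / 400), ∀ r : ℂ,
      ‖r - (⟨361/500, -33/125⟩ : ℂ)‖ ≤ 37 / 1000 → fracCoeff (n + 6) * μ + r ≠ 0 ∧
      ‖(fracCoeff (n + 6) * μ + r)⁻¹ - (⟨361/500, -33/125⟩ : ℂ)‖ ≤ 37 / 1000 := by
    intro n μ hμ r hr
    have h4 := four_le_fracCoeff (n + 6)
    have h5 := fracCoeff_le (k := n + 6) (by omega)
    refine inv_mem_disc_of_re_im (γ := 769 / 1000) (η := 63 / 10000) (by linarith)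
      (mem_closedBall_iff_norm.mp hμ) hr (by norm_num) (by norm_num) (by norm_num) ?_
      (by linarith) (by linarith)
    simp only [muApprox]
    nlinarith [mul_nonneg (sub_nonneg.mpr h4) (sub_nonneg.mpr h5)]
  obtain ⟨R, hRd, hRs, hRl⟩ := exists_continuedFraction (b := fun n => fracCoeff (n + 6))
    (D := Metric.closedBall muApprox (1 / 400)) (γ := 806 / 1000) (β := 452 / 111) (K := 38 / 5)
    (fun n => by linarith [four_le_fracCoeff (n + 6)]) (fun n => fracCoeff_le (by omega))
    (by norm_num) htail
    (by
      have : ‖(⟨361/500, -33/125⟩ : ℂ)‖ ≤ 769 / 1000 :=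
        norm_le_of_sq_add_sq_le (by norm_num) (by norm_num)
      linarith)
    (by norm_num) (by norm_num) (by norm_num)
  have hcenter : muApprox ∈ Metric.closedBall muApprox (1 / 400) :=
    Metric.mem_closedBall_self (by norm_num)
  set r5 : ℂ → ℂ := fun μ => (fracCoeff 5 * μ + R 0 μ)⁻¹ with hr5
  set r4 : ℂ → ℂ := fun μ => (fracCoeff 4 * μ + r5 μ)⁻¹ with hr4
  set r3 : ℂ → ℂ := fun μ => (fracCoeff 3 * μ + r4 μ)⁻¹ with hr3
  set r2 : ℂ → ℂ := fun μ => (fracCoeff 2 * μ + r3 μ)⁻¹ with hr2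
  set r1 : ℂ → ℂ := fun μ => (fracCoeff 1 * μ + r2 μ)⁻¹ with hr1
  set r0 : ℂ → ℂ := fun μ => (fracCoeff 0 * μ + r1 μ)⁻¹ with hr0
  have h5 : ∀ μ ∈ Metric.closedBall muApprox (1 / 400), fracCoeff 5 * μ + R 0 μ ≠ 0 ∧
      ‖r5 μ - (⟨357/500, -53/200⟩ : ℂ)‖ ≤ 29/1000 := fun μ hμ =>
    inv_mem_disc_of_re_im (γ := 381/500) (η := 3/5000) (by norm_num [fracCoeff, muApprox])
      (mem_closedBall_iff_norm.mp hμ) (hRd 0 μ hμ) (by norm_num) (by norm_num) (by norm_num)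
      (by norm_num [fracCoeff, muApprox]) (by norm_num [fracCoeff, muApprox])
      (by norm_num [fracCoeff, muApprox])
  have h4 : ∀ μ ∈ Metric.closedBall muApprox (1 / 400), fracCoeff 4 * μ + r5 μ ≠ 0 ∧
      ‖r4 μ - (⟨357/500, -269/1000⟩ : ℂ)‖ ≤ 121/5000 := fun μ hμ =>
    inv_mem_disc_of_re_im (γ := 763/1000) (η := 7/10000) (by norm_num [fracCoeff, muApprox])
      (mem_closedBall_iff_norm.mp hμ) ((h5 μ hμ).2) (by norm_num) (by norm_num) (by norm_num)
      (by norm_num [fracCoeff, muApprox]) (by norm_num [fracCoeff, muApprox])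
      (by norm_num [fracCoeff, muApprox])
  have h3 : ∀ μ ∈ Metric.closedBall muApprox (1 / 400), fracCoeff 3 * μ + r4 μ ≠ 0 ∧
      ‖r3 μ - (⟨7067/10000, -539/2000⟩ : ℂ)‖ ≤ 209/10000 := fun μ hμ =>
    inv_mem_disc_of_re_im (γ := 757/1000) (η := 1/2000) (by norm_num [fracCoeff, muApprox])
      (mem_closedBall_iff_norm.mp hμ) ((h4 μ hμ).2) (by norm_num) (by norm_num) (by norm_num)
      (by norm_num [fracCoeff, muApprox]) (by norm_num [fracCoeff, muApprox])
      (by norm_num [fracCoeff, muApprox])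
  have h2 : ∀ μ ∈ Metric.closedBall muApprox (1 / 400), fracCoeff 2 * μ + r3 μ ≠ 0 ∧
      ‖r2 μ - (⟨693/1000, -1377/5000⟩ : ℂ)‖ ≤ 91/5000 := fun μ hμ =>
    inv_mem_disc_of_re_im (γ := 373/500) (η := 1/10000) (by norm_num [fracCoeff, muApprox])
      (mem_closedBall_iff_norm.mp hμ) ((h3 μ hμ).2) (by norm_num) (by norm_num) (by norm_num)
      (by norm_num [fracCoeff, muApprox]) (by norm_num [fracCoeff, muApprox])
      (by norm_num [fracCoeff, muApprox])
  have h1 : ∀ μ ∈ Metric.closedBall muApprox (1 / 400), fracCoeff 1 * μ + r2 μ ≠ 0 ∧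
      ‖r1 μ - (⟨6573/10000, -2857/10000⟩ : ℂ)‖ ≤ 159/10000 := fun μ hμ =>
    inv_mem_disc_of_re_im (γ := 717/1000) (η := 1/10000) (by norm_num [fracCoeff, muApprox])
      (mem_closedBall_iff_norm.mp hμ) ((h2 μ hμ).2) (by norm_num) (by norm_num) (by norm_num)
      (by norm_num [fracCoeff, muApprox]) (by norm_num [fracCoeff, muApprox])
      (by norm_num [fracCoeff, muApprox])
  have h0 : ∀ μ ∈ Metric.closedBall muApprox (1 / 400), fracCoeff 0 * μ + r1 μ ≠ 0 ∧
      ‖r0 μ - (⟨1241/2500, -1483/5000⟩ : ℂ)‖ ≤ 7/625 := fun μ hμ =>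
    inv_mem_disc_of_re_im (γ := 579/1000) (η := 1/10000) (by norm_num [fracCoeff, muApprox])
      (mem_closedBall_iff_norm.mp hμ) ((h1 μ hμ).2) (by norm_num) (by norm_num) (by norm_num)
      (by norm_num [fracCoeff, muApprox]) (by norm_num [fracCoeff, muApprox])
      (by norm_num [fracCoeff, muApprox])
  -- the same discs at `muApprox` itself, where they shrink (`ε = 0`)
  have k5 : ‖r5 muApprox - (⟨357/500, -53/200⟩ : ℂ)‖ ≤ 113/5000 :=
    (inv_mem_disc_of_re_im (γ := 381/500) (η := 3/5000) (ε := 0) (μ₀ := muApprox)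
      (by norm_num [fracCoeff, muApprox]) (by simp) (hRd 0 muApprox hcenter)
      (by norm_num) (by norm_num) (by norm_num)
      (by norm_num [fracCoeff, muApprox]) (by norm_num [fracCoeff, muApprox])
      (by norm_num [fracCoeff, muApprox])).2
  have k4 : ‖r4 muApprox - (⟨357/500, -269/1000⟩ : ℂ)‖ ≤ 7/500 :=
    (inv_mem_disc_of_re_im (γ := 763/1000) (η := 7/10000) (ε := 0) (μ₀ := muApprox)
      (by norm_num [fracCoeff, muApprox]) (by simp) (k5) (by norm_num) (by norm_num) (by norm_num)
      (by norm_num [fracCoeff, muApprox]) (by norm_num [fracCoeff, muApprox])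
      (by norm_num [fracCoeff, muApprox])).2
  have k3 : ‖r3 muApprox - (⟨7067/10000, -539/2000⟩ : ℂ)‖ ≤ 17/2000 :=
    (inv_mem_disc_of_re_im (γ := 757/1000) (η := 1/2000) (ε := 0) (μ₀ := muApprox)
      (by norm_num [fracCoeff, muApprox]) (by simp) (k4) (by norm_num) (by norm_num) (by norm_num)
      (by norm_num [fracCoeff, muApprox]) (by norm_num [fracCoeff, muApprox])
      (by norm_num [fracCoeff, muApprox])).2
  have k2 : ‖r2 muApprox - (⟨693/1000, -1377/5000⟩ : ℂ)‖ ≤ 49/10000 :=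
    (inv_mem_disc_of_re_im (γ := 373/500) (η := 1/10000) (ε := 0) (μ₀ := muApprox)
      (by norm_num [fracCoeff, muApprox]) (by simp) (k3) (by norm_num) (by norm_num) (by norm_num)
      (by norm_num [fracCoeff, muApprox]) (by norm_num [fracCoeff, muApprox])
      (by norm_num [fracCoeff, muApprox])).2
  have k1 : ‖r1 muApprox - (⟨6573/10000, -2857/10000⟩ : ℂ)‖ ≤ 27/10000 :=
    (inv_mem_disc_of_re_im (γ := 717/1000) (η := 1/10000) (ε := 0) (μ₀ := muApprox)
      (by norm_num [fracCoeff, muApprox]) (by simp) (k2) (by norm_num) (by norm_num) (by norm_num)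
      (by norm_num [fracCoeff, muApprox]) (by norm_num [fracCoeff, muApprox])
      (by norm_num [fracCoeff, muApprox])).2
  have k0 : ‖r0 muApprox - (⟨1241/2500, -1483/5000⟩ : ℂ)‖ ≤ 1/1000 :=
    (inv_mem_disc_of_re_im (γ := 579/1000) (η := 1/10000) (ε := 0) (μ₀ := muApprox)
      (by norm_num [fracCoeff, muApprox]) (by simp) (k1) (by norm_num) (by norm_num) (by norm_num)
      (by norm_num [fracCoeff, muApprox]) (by norm_num [fracCoeff, muApprox])
      (by norm_num [fracCoeff, muApprox])).2
  have n5 : ∀ μ ∈ Metric.closedBall muApprox (1 / 400), ‖r5 μ‖ ≤ 791/1000 := fun μ hμ =>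
    (norm_le_of_norm_sub_le (γ := 381/500) (by norm_num)
      (by norm_num) (h5 μ hμ).2).trans (by norm_num)
  have n4 : ∀ μ ∈ Metric.closedBall muApprox (1 / 400), ‖r4 μ‖ ≤ 492/625 := fun μ hμ =>
    (norm_le_of_norm_sub_le (γ := 763/1000) (by norm_num)
      (by norm_num) (h4 μ hμ).2).trans (by norm_num)
  have n3 : ∀ μ ∈ Metric.closedBall muApprox (1 / 400), ‖r3 μ‖ ≤ 7779/10000 := fun μ hμ =>
    (norm_le_of_norm_sub_le (γ := 757/1000) (by norm_num)
      (by norm_num) (h3 μ hμ).2).trans (by norm_num)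
  have n2 : ∀ μ ∈ Metric.closedBall muApprox (1 / 400), ‖r2 μ‖ ≤ 3821/5000 := fun μ hμ =>
    (norm_le_of_norm_sub_le (γ := 373/500) (by norm_num)
      (by norm_num) (h2 μ hμ).2).trans (by norm_num)
  have n1 : ∀ μ ∈ Metric.closedBall muApprox (1 / 400), ‖r1 μ‖ ≤ 7329/10000 := fun μ hμ =>
    (norm_le_of_norm_sub_le (γ := 717/1000) (by norm_num)
      (by norm_num) (h1 μ hμ).2).trans (by norm_num)
  have n0 : ∀ μ ∈ Metric.closedBall muApprox (1 / 400), ‖r0 μ‖ ≤ 2951/5000 := fun μ hμ =>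
    (norm_le_of_norm_sub_le (γ := 579/1000) (by norm_num)
      (by norm_num) (h0 μ hμ).2).trans (by norm_num)
  -- Lipschitz constants in `μ`, by absolute values down to level `2`
  have l5 : ∀ μ ∈ Metric.closedBall muApprox (1 / 400),
      ∀ μ' ∈ Metric.closedBall muApprox (1 / 400),
      ‖r5 μ - r5 μ'‖ ≤ 183/25 * ‖μ - μ'‖ := fun μ hμ μ' hμ' =>
    norm_inv_sub_inv_le (by norm_num [fracCoeff, muApprox]) (h5 μ hμ).1 (h5 μ' hμ').1 (n5 μ hμ)
      (n5 μ' hμ') (hRl 0 μ hμ μ' hμ') (by norm_num [fracCoeff, muApprox])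
  have l4 : ∀ μ ∈ Metric.closedBall muApprox (1 / 400),
      ∀ μ' ∈ Metric.closedBall muApprox (1 / 400),
      ‖r4 μ - r4 μ'‖ ≤ 71/10 * ‖μ - μ'‖ := fun μ hμ μ' hμ' =>
    norm_inv_sub_inv_le (by norm_num [fracCoeff, muApprox]) (h4 μ hμ).1 (h4 μ' hμ').1 (n4 μ hμ)
      (n4 μ' hμ') (l5 μ hμ μ' hμ') (by norm_num [fracCoeff, muApprox])
  have l3 : ∀ μ ∈ Metric.closedBall muApprox (1 / 400),
      ∀ μ' ∈ Metric.closedBall muApprox (1 / 400),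
      ‖r3 μ - r3 μ'‖ ≤ 137/20 * ‖μ - μ'‖ := fun μ hμ μ' hμ' =>
    norm_inv_sub_inv_le (by norm_num [fracCoeff, muApprox]) (h3 μ hμ).1 (h3 μ' hμ').1 (n3 μ hμ)
      (n3 μ' hμ') (l4 μ hμ μ' hμ') (by norm_num [fracCoeff, muApprox])
  have l2 : ∀ μ ∈ Metric.closedBall muApprox (1 / 400),
      ∀ μ' ∈ Metric.closedBall muApprox (1 / 400),
      ‖r2 μ - r2 μ'‖ ≤ 327/50 * ‖μ - μ'‖ := fun μ hμ μ' hμ' =>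
    norm_inv_sub_inv_le (by norm_num [fracCoeff, muApprox]) (h2 μ hμ).1 (h2 μ' hμ').1 (n2 μ hμ)
      (n2 μ' hμ') (l3 μ hμ μ' hμ') (by norm_num [fracCoeff, muApprox])
  have l0 : ∀ μ ∈ Metric.closedBall muApprox (1 / 400),
      ∀ μ' ∈ Metric.closedBall muApprox (1 / 400),
      ‖r0 μ - r0 μ'‖ ≤ 16 / 5 * ‖μ - μ'‖ := by
    intro μ hμ μ' hμ'
    set c : ℂ := ⟨6573/10000, -2857/10000⟩ with hc
    have e1 : r1 μ - r1 μ' =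
        -(r1 μ * r1 μ') * (fracCoeff 1 * μ + r2 μ - (fracCoeff 1 * μ' + r2 μ')) :=
      inv_sub_inv_eq_neg_mul (h1 μ hμ).1 (h1 μ' hμ').1
    have e0 : r0 μ - r0 μ' =
        -(r0 μ * r0 μ') * (fracCoeff 0 * μ + r1 μ - (fracCoeff 0 * μ' + r1 μ')) :=
      inv_sub_inv_eq_neg_mul (h0 μ hμ).1 (h0 μ' hμ').1
    have e : r0 μ - r0 μ' = -(r0 μ * r0 μ') *
        ((((fracCoeff 0 : ℂ) - fracCoeff 1 * (c * c)) - fracCoeff 1 * ((r1 μ - c) * r1 μ' +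
          c * (r1 μ' - c))) * (μ - μ') - r1 μ * r1 μ' * (r2 μ - r2 μ')) := by
      rw [e0, show fracCoeff 0 * μ + r1 μ - (fracCoeff 0 * μ' + r1 μ') =
        fracCoeff 0 * (μ - μ') + (r1 μ - r1 μ') by ring, e1]
      ring
    -- `-r1² b₁` partially cancels `b₀`: freeze `r1` at the centre `c` of its disc to keep the phase
    have hcn : ‖c‖ ≤ 717 / 1000 := norm_le_of_sq_add_sq_le (by norm_num) (by norm_num [hc])
    have hb1 : ‖(fracCoeff 1 : ℂ)‖ = 52 / 11 := by
      rw [Complex.norm_real]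
      norm_num [fracCoeff]
    have hlead : ‖(fracCoeff 0 : ℂ) - fracCoeff 1 * (c * c)‖ ≤ 532 / 100 := by
      refine norm_le_of_sq_add_sq_le (by norm_num) ?_
      rw [Complex.sub_re, Complex.sub_im, Complex.re_ofReal_mul, Complex.im_ofReal_mul,
        Complex.ofReal_re, Complex.ofReal_im, Complex.mul_re, Complex.mul_im]
      norm_num [fracCoeff, hc]
    have d1 := (h1 μ hμ).2
    have d1' := (h1 μ' hμ').2
    have m0 := n0 μ hμ
    have m0' := n0 μ' hμ'
    have m1 := n1 μ hμ
    have m1' := n1 μ' hμ'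
    have hvar : ‖(fracCoeff 1 : ℂ) * ((r1 μ - c) * r1 μ' + c * (r1 μ' - c))‖ ≤ 11 / 100 := by
      rw [norm_mul, hb1]
      have hsum : ‖(r1 μ - c) * r1 μ' + c * (r1 μ' - c)‖ ≤
          159 / 10000 * (7329 / 10000) + 717 / 1000 * (159 / 10000) := by
        refine (norm_add_le _ _).trans (add_le_add ?_ ?_)
        · rw [norm_mul]
          exact mul_le_mul d1 m1' (norm_nonneg _) (by norm_num)
        · rw [norm_mul]
          exact mul_le_mul hcn d1' (norm_nonneg _) (by norm_num)
      linarith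
    rw [e, norm_mul, norm_neg, norm_mul]
    have hin : ‖(((fracCoeff 0 : ℂ) - fracCoeff 1 * (c * c)) - fracCoeff 1 * ((r1 μ - c) * r1 μ' +
          c * (r1 μ' - c))) * (μ - μ') - r1 μ * r1 μ' * (r2 μ - r2 μ')‖ ≤
        (543 / 100 + 7329 / 10000 * (7329 / 10000) * (327 / 50)) * ‖μ - μ'‖ := by
      rw [add_mul]
      refine (norm_sub_le _ _).trans (add_le_add ?_ ?_)
      · rw [norm_mul]
        refine mul_le_mul_of_nonneg_right ((norm_sub_le _ _).trans ?_) (norm_nonneg _)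
        linarith
      · rw [norm_mul, norm_mul, mul_assoc (7329 / 10000 * (7329 / 10000) : ℝ)]
        exact mul_le_mul (mul_le_mul m1 m1' (norm_nonneg _) (by norm_num))
          (l2 μ hμ μ' hμ') (norm_nonneg _) (by norm_num)
    calc ‖r0 μ‖ * ‖r0 μ'‖ * _ ≤ 2951 / 5000 * (2951 / 5000) *
          ((543 / 100 + 7329 / 10000 * (7329 / 10000) * (327 / 50)) * ‖μ - μ'‖) :=
          mul_le_mul (mul_le_mul m0 m0' (norm_nonneg _) (by norm_num)) hin (norm_nonneg _)
            (by norm_num)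
      _ ≤ 16 / 5 * ‖μ - μ'‖ := by nlinarith [norm_nonneg (μ - μ')]
  set Φ : ℂ → ℂ := fun μ => (r0 μ + Complex.I) / 4 with hΦ
  have hΦl : ∀ μ ∈ Metric.closedBall muApprox (1 / 400),
      ∀ μ' ∈ Metric.closedBall muApprox (1 / 400),
      ‖Φ μ - Φ μ'‖ ≤ 4 / 5 * ‖μ - μ'‖ := by
    intro μ hμ μ' hμ'
    have e : Φ μ - Φ μ' = (r0 μ - r0 μ') / 4 := by
      rw [hΦ]
      ring
    rw [e, norm_div]
    have h4 : ‖(4 : ℂ)‖ = 4 := by norm_num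
    rw [h4, div_le_iff₀ (by norm_num)]
    linarith [l0 μ hμ μ' hμ']
  have hΦ0 : ‖Φ muApprox - muApprox‖ ≤ 3 / 10000 + 1 / 100000 := by
    have e : Φ muApprox - muApprox = (r0 muApprox - (⟨1241/2500, -1483/5000⟩ : ℂ)) / 4 +
        ((⟨1241/2500, -1483/5000⟩ + Complex.I) / 4 - muApprox) := by
      rw [hΦ]
      ring
    have hrest : ‖((⟨1241/2500, -1483/5000⟩ + Complex.I) / 4 - muApprox : ℂ)‖ ≤ 6 / 100000 := by
      refine norm_le_of_sq_add_sq_le (by norm_num) ?_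
      rw [show ((⟨1241/2500, -1483/5000⟩ + Complex.I) / 4 - muApprox : ℂ) = ⟨0, -1/20000⟩ by
        apply Complex.ext <;> norm_num [muApprox, Complex.div_re, Complex.div_im]]
      norm_num
    rw [e]
    refine (norm_add_le _ _).trans ?_
    rw [norm_div]
    have h4 : ‖(4 : ℂ)‖ = 4 := by norm_num
    rw [h4]
    linarith
  have hmaps : Set.MapsTo Φ (Metric.closedBall muApprox (1 / 400))
      (Metric.closedBall muApprox (1 / 400)) := by
    intro μ hμ
    have hμ1 := mem_closedBall_iff_norm.mp hμ
    rw [mem_closedBall_iff_norm]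
    calc ‖Φ μ - muApprox‖ = ‖(Φ μ - Φ muApprox) + (Φ muApprox - muApprox)‖ := by
          rw [sub_add_sub_cancel]
      _ ≤ ‖Φ μ - Φ muApprox‖ + ‖Φ muApprox - muApprox‖ := norm_add_le _ _
      _ ≤ 1 / 400 := by linarith [hΦl μ hμ muApprox hcenter]
  have hcontr : ContractingWith (4 / 5) (hmaps.restrict Φ _ _) := by
    refine ⟨by rw [← NNReal.coe_lt_coe]; norm_num, LipschitzWith.of_dist_le_mul fun x y => ?_⟩
    have h := hΦl x x.2 y y.2
    rw [← dist_eq_norm, ← dist_eq_norm] at h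
    exact_mod_cast h
  obtain ⟨μ, hμ, hfix, -⟩ := hcontr.exists_fixedPoint' Metric.isClosed_closedBall.isComplete hmaps
    hcenter (edist_ne_top _ _)
  have hfix' : (r0 μ + Complex.I) / 4 = μ := hfix
  refine ⟨μ, fun k => match k with
    | 0 => r0 μ | 1 => r1 μ | 2 => r2 μ | 3 => r3 μ | 4 => r4 μ | 5 => r5 μ | n + 6 => R n μ,
    ?_, ?_, ?_, ?_, ?_⟩
  · have h1 := (Complex.abs_re_le_norm (μ - muApprox)).trans (mem_closedBall_iff_norm.mp hμ)
    rw [Complex.sub_re, abs_le] at h1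
    have h2 : muApprox.re = 1241 / 10000 := rfl
    linarith [h1.1]
  · intro k
    match k with
    | 0 => exact (h0 μ hμ).1
    | 1 => exact (h1 μ hμ).1
    | 2 => exact (h2 μ hμ).1
    | 3 => exact (h3 μ hμ).1
    | 4 => exact (h4 μ hμ).1
    | 5 => exact (h5 μ hμ).1
    | n + 6 => exact (htail n μ hμ _ (hRd (n + 1) μ hμ)).1
  · intro k
    match k with
    | 0 => rfl
    | 1 => rfl
    | 2 => rfl
    | 3 => rfl
    | 4 => rfl
    | 5 => rfl
    | n + 6 => exact hRs n μ hμ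
  · intro k
    match k with
    | 0 => exact (n0 μ hμ).trans (by norm_num)
    | 1 => exact (n1 μ hμ).trans (by norm_num)
    | 2 => exact (n2 μ hμ).trans (by norm_num)
    | 3 => exact (n3 μ hμ).trans (by norm_num)
    | 4 => exact (n4 μ hμ).trans (by norm_num)
    | 5 => exact (n5 μ hμ).trans (by norm_num)
    | n + 6 =>
      exact (norm_le_of_norm_sub_le (γ := 769 / 1000) (by norm_num) (by norm_num)
        (hRd n μ hμ)).trans (by norm_num)
  · change 4 * μ = r0 μ + Complex.I
    linear_combination -4 * hfix'

end FixedPoint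

/-! ### The hyperbolic eigenvectors -/

section Eigenvector

theorem lineA_two : lineA 2 = 1 / 4 := by
  rw [lineA_eq, waveNormSq_lineMode]
  norm_num

theorem lineA_three : lineA 3 = 1 / 4 := by
  rw [lineA_eq, waveNormSq_lineMode]
  norm_num

theorem waveNormSq_lineMode_add_three (k : ℕ) :
    waveNormSq (lineMode (k + 3)) = (k : ℝ) ^ 2 + (k + 1) ^ 2 := by
  rw [waveNormSq_lineMode]
  push_cast
  ring

theorem inv_lineA_add_four (k : ℕ) : (lineA (k + 4))⁻¹ = -fracCoeff k := by
  rw [lineA_eq, waveNormSq_lineMode, fracCoeff]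
  push_cast
  have h1 : (0 : ℝ) < 2 * (k : ℝ) ^ 2 + 6 * k + 3 := by positivity
  have h2 : ((k : ℝ) + 4 - 3) ^ 2 + ((k : ℝ) + 4 - 2) ^ 2 = 2 * (k : ℝ) ^ 2 + 6 * k + 5 := by ring
  rw [h2]
  have h3 : (0 : ℝ) < 2 * (k : ℝ) ^ 2 + 6 * k + 5 := by positivity
  have h4 : (1 : ℝ) / 2 * ((2 * (k : ℝ) ^ 2 + 6 * k + 5)⁻¹ - 1 / 2) =
      -((2 * (k : ℝ) ^ 2 + 6 * k + 3) / (4 * (2 * (k : ℝ) ^ 2 + 6 * k + 5))) := by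
    field_simp
    ring
  rw [h4, inv_neg, inv_div]

theorem abs_inv_lineA_add_three_le (k : ℕ) : |(lineA (k + 3))⁻¹| ≤ 7 := by
  rcases k with _ | k
  · simp only [Nat.cast_zero, zero_add, lineA_three]
    norm_num
  · have h : ((k + 1 : ℕ) : ℤ) + 3 = k + 4 := by push_cast; ring
    rw [h, inv_lineA_add_four, abs_neg, abs_of_nonneg (by linarith [four_le_fracCoeff k]),
      fracCoeff, div_le_iff₀ (by positivity)]
    nlinarith [sq_nonneg (k : ℝ), (Nat.cast_nonneg k : (0 : ℝ) ≤ k)]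

/-- The partial products of `r`. They are the values of `A_n c_n` at `n = k + 3`, normalized to `1`
at `n = 3`, where `c_n = a_n - i (-1)^n a_{5-n}` is the complex notation for a real sequence `a`. -/
def fracProd (r : ℕ → ℂ) : ℕ → ℂ
  | 0 => 1
  | k + 1 => r k * fracProd r k

/-- The complex sequence with `A_n c_n` given by `fracProd` for `n ≥ 3`, extended to all `n` by the
symmetry `c_n = -i (-1)^n c_{5-n}`. -/
noncomputable def eigenSeq (r : ℕ → ℂ) (n : ℤ) : ℂ :=
  if 3 ≤ n then fracProd r (n - 3).toNat * ((lineA n)⁻¹ : ℝ)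
  else -Complex.I * (-1) ^ n * (fracProd r (2 - n).toNat * ((lineA n)⁻¹ : ℝ))

variable {r : ℕ → ℂ} {μ : ℂ}

theorem eigenSeq_add_three (r : ℕ → ℂ) (k : ℕ) :
    eigenSeq r (k + 3) = fracProd r k * ((lineA (k + 3))⁻¹ : ℝ) := by
  rw [eigenSeq, if_pos (by omega)]
  simp

theorem complex_neg_one_zpow_mul_self (n : ℤ) : (-1 : ℂ) ^ n * (-1 : ℂ) ^ n = 1 := by
  rw [← mul_zpow]
  norm_num

theorem complex_neg_one_zpow_reflect (n : ℤ) : (-1 : ℂ) ^ (5 - n) = -(-1 : ℂ) ^ n := by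
  rw [zpow_sub₀ (by norm_num), div_eq_iff (zpow_ne_zero _ (by norm_num)), neg_mul,
    complex_neg_one_zpow_mul_self]
  norm_num

theorem eigenSeq_reflect (r : ℕ → ℂ) (n : ℤ) :
    eigenSeq r (5 - n) = Complex.I * (-1) ^ n * eigenSeq r n := by
  by_cases h : 3 ≤ n
  · rw [eigenSeq, if_neg (by omega), eigenSeq, if_pos h, lineA_reflect,
      complex_neg_one_zpow_reflect, show 2 - (5 - n) = n - 3 by ring]
    ring
  · rw [eigenSeq, if_pos (by omega), eigenSeq, if_neg h, lineA_reflect,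
      show 5 - n - 3 = 2 - n by ring]
    have h1 := complex_neg_one_zpow_mul_self n
    have h2 := Complex.I_mul_I
    linear_combination (-(fracProd r (2 - n).toNat * ((lineA n)⁻¹ : ℝ))) * h1 +
      (fracProd r (2 - n).toNat * ((lineA n)⁻¹ : ℝ)) * (-1) ^ n * (-1) ^ n * h2

theorem lineA_ne_zero (n : ℤ) : lineA n ≠ 0 := by
  by_cases h2 : n = 2
  · rw [h2, lineA_two]; norm_num
  by_cases h3 : n = 3
  · rw [h3, lineA_three]; norm_num
  exact (lineA_neg h2 h3).ne

theorem lineA_mul_eigenSeq (r : ℕ → ℂ) (k : ℕ) :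
    (lineA (k + 3) : ℂ) * eigenSeq r (k + 3) = fracProd r k := by
  rw [eigenSeq_add_three, mul_left_comm, ← Complex.ofReal_mul, mul_inv_cancel₀ (lineA_ne_zero _),
    Complex.ofReal_one, mul_one]

/-- The eigenvalue equation in complex notation: above the middle it is the recursion for the
continued fraction, in the middle the boundary condition, and below it follows by symmetry. -/
theorem eigenSeq_recurrence (h0 : ∀ k, fracCoeff k * μ + r (k + 1) ≠ 0)
    (hr : ∀ k, r k = (fracCoeff k * μ + r (k + 1))⁻¹) (hμ : 4 * μ = r 0 + Complex.I) (n : ℤ) :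
    -μ * eigenSeq r n =
      lineA (n - 1) * eigenSeq r (n - 1) - lineA (n + 1) * eigenSeq r (n + 1) := by
  have key : ∀ k : ℕ, -μ * eigenSeq r (k + 3) =
      lineA (k + 3 - 1) * eigenSeq r (k + 3 - 1) - lineA (k + 3 + 1) * eigenSeq r (k + 3 + 1) := by
    intro k
    rcases k with _ | k
    · have h1 := lineA_mul_eigenSeq r 0
      have h2 := lineA_mul_eigenSeq r 1
      have h3 := eigenSeq_reflect r 3
      simp only [Nat.cast_zero, zero_add, Nat.cast_one, fracProd, lineA_three,
        show (5 : ℤ) - 3 = 2 by norm_num, show (1 : ℤ) + 3 = 4 by norm_num] at h1 h2 h3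
      simp only [Nat.cast_zero, zero_add, show (3 : ℤ) - 1 = 2 by norm_num,
        show (3 : ℤ) + 1 = 4 by norm_num]
      have h4 : ((-1 : ℂ)) ^ (3 : ℤ) = -1 := by norm_num
      rw [h4] at h3
      rw [h2, h3, lineA_two]
      push_cast at h1 ⊢
      linear_combination (-μ * 4 + Complex.I) * h1 - hμ
    · have h1 := lineA_mul_eigenSeq r k
      have h2 := lineA_mul_eigenSeq r (k + 2)
      have h3 := eigenSeq_add_three r (k + 1)
      rw [show ((k + 1 : ℕ) : ℤ) + 3 = k + 4 by push_cast; ring] at h3 ⊢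
      rw [show ((k + 2 : ℕ) : ℤ) + 3 = k + 4 + 1 by push_cast; ring] at h2
      rw [show (k : ℤ) + 4 - 1 = k + 3 by ring, h1, h2, h3, inv_lineA_add_four]
      have h4 : r k * (fracCoeff k * μ + r (k + 1)) = 1 := by
        rw [hr k, inv_mul_cancel₀ (h0 k)]
      simp only [fracProd]
      push_cast
      linear_combination fracProd r k * h4
  rcases le_or_gt 3 n with h | h
  · obtain ⟨k, rfl⟩ : ∃ k : ℕ, n = k + 3 := ⟨(n - 3).toNat, by omega⟩
    exact key k
  · obtain ⟨k, hk⟩ : ∃ k : ℕ, 5 - n = k + 3 := ⟨(2 - n).toNat, by omega⟩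
    have h1 := key k
    rw [← hk, show 5 - n - 1 = 5 - (n + 1) by ring, show 5 - n + 1 = 5 - (n - 1) by ring,
      lineA_reflect, lineA_reflect, eigenSeq_reflect, eigenSeq_reflect, eigenSeq_reflect,
      zpow_add_one₀ (by norm_num), zpow_sub_one₀ (by norm_num)] at h1
    have h2 : (Complex.I * (-1) ^ n : ℂ) ≠ 0 :=
      mul_ne_zero Complex.I_ne_zero (zpow_ne_zero _ (by norm_num))
    apply mul_left_cancel₀ h2
    rw [show ((-1 : ℂ))⁻¹ = -1 by norm_num] at h1
    linear_combination h1

theorem im_eigenSeq (r : ℕ → ℂ) (n : ℤ) :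
    (eigenSeq r n).im = -((-1 : ℝ) ^ n * (eigenSeq r (5 - n)).re) := by
  rw [eigenSeq_reflect]
  have h : ((-1 : ℂ)) ^ n = (((-1 : ℝ) ^ n : ℝ) : ℂ) := by push_cast; rfl
  have h1 : (Complex.I * (-1) ^ n * eigenSeq r n).re = -((-1 : ℝ) ^ n * (eigenSeq r n).im) := by
    rw [h, mul_assoc, Complex.I_mul_re, Complex.im_ofReal_mul]
  rw [h1]
  linear_combination -(eigenSeq r n).im * neg_one_zpow_mul_self n

theorem norm_fracProd_le (hr : ∀ k, ‖r k‖ ≤ 9 / 10) (k : ℕ) : ‖fracProd r k‖ ≤ (9 / 10) ^ k := by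
  induction k with
  | zero => simp [fracProd]
  | succ k ih =>
    rw [fracProd, norm_mul, pow_succ']
    exact mul_le_mul (hr k) ih (norm_nonneg _) (by norm_num)

/-- The sequence decays exponentially, hence belongs to all Sobolev spaces. -/
theorem re_eigenSeq_mem (s : ℝ) (hr : ∀ k, ‖r k‖ ≤ 9 / 10) :
    (fun n => (eigenSeq r n).re) ∈ lineSobolevSubmodule s := by
  change Memℓp (fun n => sobolevWeight s n * (eigenSeq r n).re) 2
  apply memℓp_two_of_summable_sq
  have hle : ∀ n, (sobolevWeight s n * (eigenSeq r n).re) ^ 2 ≤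
      sobolevWeight s n ^ 2 * ‖eigenSeq r n‖ ^ 2 := by
    intro n
    rw [mul_pow]
    refine mul_le_mul_of_nonneg_left ?_ (sq_nonneg _)
    rw [← sq_abs]
    exact pow_le_pow_left₀ (abs_nonneg _) (Complex.abs_re_le_norm _) 2
  refine Summable.of_nonneg_of_le (fun n => sq_nonneg _) hle ?_
  have hrefl : ∀ n, sobolevWeight s (5 - n) ^ 2 * ‖eigenSeq r (5 - n)‖ ^ 2 =
      sobolevWeight s n ^ 2 * ‖eigenSeq r n‖ ^ 2 := by
    intro n
    rw [sobolevWeight_reflect, eigenSeq_reflect, norm_mul, norm_mul, norm_zpow, norm_neg, norm_one,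
      one_zpow, Complex.norm_I, one_mul, one_mul]
  obtain ⟨N, hN⟩ := exists_nat_ge s
  have hmain : Summable fun k : ℕ => sobolevWeight s ((k : ℤ) + 3) ^ 2 *
      ‖eigenSeq r ((k : ℤ) + 3)‖ ^ 2 := by
    have hgeo := (summable_nat_add_iff 1).mpr
      (summable_pow_mul_geometric_of_norm_lt_one (2 * N) (r := (81 / 100 : ℝ)) (by norm_num))
    refine Summable.of_nonneg_of_le (fun k => by positivity) (fun k => ?_)
      (hgeo.mul_left (2 ^ N * 49 * (100 / 81)))
    -- polynomial growth of the weight against the geometric decay `0.81^k` of the square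
    have h1 : sobolevWeight s ((k : ℤ) + 3) ^ 2 ≤ 2 ^ N * ((k + 1 : ℕ) : ℝ) ^ (2 * N) := by
      have hκ := one_le_waveNormSq_lineMode ((k : ℤ) + 3)
      have e : sobolevWeight s ((k : ℤ) + 3) ^ 2 = waveNormSq (lineMode ((k : ℤ) + 3)) ^ s := by
        rw [sobolevWeight, ← Real.rpow_natCast, ← Real.rpow_mul (by linarith)]
        norm_num
      rw [e]
      calc waveNormSq (lineMode ((k : ℤ) + 3)) ^ s
          ≤ waveNormSq (lineMode ((k : ℤ) + 3)) ^ (N : ℝ) := Real.rpow_le_rpow_of_exponent_le hκ hN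
        _ = waveNormSq (lineMode ((k : ℤ) + 3)) ^ N := Real.rpow_natCast _ _
        _ ≤ (2 * ((k + 1 : ℕ) : ℝ) ^ 2) ^ N := by
            refine pow_le_pow_left₀ (by linarith) ?_ N
            rw [waveNormSq_lineMode_add_three]
            push_cast
            nlinarith [(Nat.cast_nonneg k : (0 : ℝ) ≤ k)]
        _ = 2 ^ N * ((k + 1 : ℕ) : ℝ) ^ (2 * N) := by rw [mul_pow, pow_mul]
    have h2 : ‖eigenSeq r ((k : ℤ) + 3)‖ ^ 2 ≤ 49 * (81 / 100) ^ k := by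
      rw [eigenSeq_add_three, norm_mul, mul_pow, Complex.norm_real, Real.norm_eq_abs]
      have h3 := pow_le_pow_left₀ (norm_nonneg _) (norm_fracProd_le hr k) 2
      have h4 := pow_le_pow_left₀ (abs_nonneg _) (abs_inv_lineA_add_three_le k) 2
      rw [← pow_mul, mul_comm k 2, pow_mul, show ((9 : ℝ) / 10) ^ 2 = 81 / 100 by norm_num] at h3
      calc _ ≤ (81 / 100 : ℝ) ^ k * 7 ^ 2 := mul_le_mul h3 h4 (by positivity) (by positivity)
        _ = 49 * (81 / 100) ^ k := by ring
    calc _ ≤ 2 ^ N * ((k + 1 : ℕ) : ℝ) ^ (2 * N) * (49 * (81 / 100) ^ k) :=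
          mul_le_mul h1 h2 (by positivity) (by positivity)
      _ = _ := by rw [pow_succ (81 / 100 : ℝ) k]; ring
  rw [summable_int_iff_summable_nat_and_neg]
  constructor
  · refine (summable_nat_add_iff 3).mp (hmain.congr fun k => ?_)
    push_cast
    rfl
  · refine ((summable_nat_add_iff 2).mpr hmain).congr fun k => ?_
    rw [← hrefl (-(k : ℤ)), show ((k + 2 : ℕ) : ℤ) + 3 = 5 - -(k : ℤ) by push_cast; ring]

/-- A hyperbolic pair of eigenvectors of the linearized operator exists. -/
theorem exists_isDualPair_line {s : ℝ} (hs : 0 ≤ s) : ∃ (x y : ℝ) (v w : LineSobolev s),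
    0 < x ∧ IsDualPair (lineL s) (lineK s) (lineForm hs) x y v w := by
  obtain ⟨μ, r, hμ0, h0, hr, hr9, hμ⟩ := exists_fraction_fixedPoint
  set a : LineSobolev s := ⟨fun n => (eigenSeq r n).re, re_eigenSeq_mem s hr9⟩ with ha
  have hcoeff : ∀ n, a.coeff n = (eigenSeq r n).re := fun _ => rfl
  have hL : lineL s a = (-μ.re) • a + (-μ.im) • lineK s a := by
    ext n
    rw [coeff_lineL, LineSobolev.coeff_add, LineSobolev.coeff_smul, LineSobolev.coeff_smul,
      coeff_lineK, hcoeff, hcoeff, hcoeff, hcoeff]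
    have h := congrArg Complex.re (eigenSeq_recurrence h0 hr hμ n)
    rw [Complex.sub_re, Complex.re_ofReal_mul, Complex.re_ofReal_mul, Complex.mul_re,
      im_eigenSeq, Complex.neg_re, Complex.neg_im] at h
    rw [← h]
    ring
  have ha0 : a ≠ 0 := by
    intro h
    have h3 : a.coeff 3 = 4 := by
      rw [hcoeff]
      have := eigenSeq_add_three r 0
      simp only [Nat.cast_zero, zero_add, fracProd, lineA_three] at this
      rw [this]
      norm_num
    rw [h, LineSobolev.coeff_zero] at h3
    norm_num at h3
  have hRa : lineR s a ≠ 0 := by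
    intro h
    apply ha0
    ext n
    have := congrArg (fun b => LineSobolev.coeff b (5 - n)) h
    simpa only [coeff_lineR, sub_sub_cancel, LineSobolev.coeff_zero] using this
  -- `a` belongs to the eigenvalue in the left half-plane, its reflection to the mirror image
  have hLR := lineL_lineR hL
  rw [neg_neg] at hLR
  obtain ⟨w, hw, hp, hpK⟩ := (isPontryaginSkew_line hs).exists_dual_eigenvector hμ0.ne' hRa ha0
    hLR hL
  exact ⟨μ.re, -μ.im, lineR s a, w, hμ0, hLR, hw, hp, hpK⟩

end Eigenvector

theorem mainTheorem2 (s : ℝ) (hs : 1 ≤ s) :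
    (∃ W : Set (LinePhase s), IsCenterUnstableManifold (lineField s) (fixedLine s) 2 W) ∧
    (∃ W : Set (LinePhase s), IsCenterStableManifold (lineField s) (fixedLine s) 2 W) ∧
    (∃ W : Set (LinePhase s), IsCenterManifold (lineField s) (fixedLine s) 4 W) := by
  have hs0 : 0 ≤ s := by linarith
  obtain ⟨x, y, v, w, hx, hp⟩ := exists_isDualPair_line hs0
  have h := isPontryaginSkew_line hs0
  have hF : ∀ x y : ℝ, x ≠ 0 → IsUnitAddCompact (shiftOp (lineL s) (lineK s) x y) :=
    fun _ y hx => isUnitAddCompact_shiftOp_line hx y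
  have hq := hasFDerivAt_lineQuad hs0
  exact ⟨⟨_, isCenterUnstableManifold h hp hx hF lineField_eq lineQuad_zero hq⟩,
    ⟨_, isCenterStableManifold h hp hx hF lineField_eq lineQuad_zero hq⟩,
    ⟨_, isCenterManifold h hp hx hF lineField_eq lineQuad_zero hq⟩⟩
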